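/- Let $K$ be a field of characteristic zero, $n\ge 1$, $P_n=K[x_1,\dots,x_n]$, and let $A_n=\mathcal D(P_n)$ be the $n$-th Weyl algebra, i.e. the $K$-algebra generated by $x_1,\dots,x_n,\partial_1,\dots,\partial_n$ subject to the defining relations $[x_i,x_j]=[\partial_i,\partial_j]=0$, $[\partial_i,x_j]=\delta_{ij}$; it acts on $P_n$ by multiplication by the $x_i$ and by $\partial_i=\partial/\partial x_i$. For polynomials $p_1,\dots,p_n\in P_n$ let $\mathcal J(p_1,\dots,p_n)=\det(\partial p_i/\partial x_j)$. Let $\sigma$ be a $K$-algebra endomorphism of $P_n$ that is a Jacobian map, i.e. $\Delta:=\mathcal J(\sigma(x_1),\dots,\sigma(x_n))\in K\setminus\{0\}$, and let $d=\deg(\sigma):=\max_i\deg\sigma(x_i)$. For $1\le i\le n$ let $\partial_i'$ be the $K$-derivation of $P_n$ given by $$\partial_i'(p)=\Delta^{-1}\,\mathcal J(\sigma(x_1),\dots,\sigma(x_{i-1}),p,\sigma(x_{i+1}),\dots,\sigma(x_n)),\qquad p\in P_n,$$ regarded as the element $\sum_j\partial_i'(x_j)\partial_j$ of $A_n$. Extend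 $\sigma$ to the $K$-algebra endomorphism of $A_n$ (again denoted $\sigma$) with $x_i\mapsto\sigma(x_i)$ and $\partial_i\mapsto\partial_i'$. Let ${}^\sigma P_n$ be the $A_n$-module with underlying vector space $P_n$ and action $a\cdot p=\sigma(a)p$. An $A_n$-module is called holonomic if it is finitely generated and has Gelfand–Kirillov dimension $n$. Then: 1. The $A_n$-module ${}^\sigma P_n$ is holonomic, has finite length, and is generated by one element. 2. The length of the $A_n$-module ${}^\sigma P_n$ is at most $m^n$, where $m=\max\{d,\ (d-1)^{n-1}-1\}$. -/

import Mathlib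

noncomputable section

namespace JacWeyl

open MvPolynomial

/-! ### Twisted modules -/

section Twisted

variable {K A : Type*} [CommSemiring K] [Ring A] [Algebra K A]

/-- For a `K`-algebra endomorphism `φ` of `A` and an `A`-module `M`, the twisted module `^φ M`:
the same vector space `M`, with `a · m := φ(a) m`. -/
def Twisted (_φ : A →ₐ[K] A) (M : Type*) : Type _ := M

variable (φ : A →ₐ[K] A) (M : Type*) [AddCommGroup M]

instance : AddCommGroup (Twisted φ M) := inferInstanceAs (AddCommGroup M)

instance [Module K M] : Module K (Twisted φ M) := inferInstanceAs (Module K M)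

instance [Module A M] : Module A (Twisted φ M) := Module.compHom M φ.toRingHom

/-- The identity map, from `M` to the underlying space of `^φ M`. -/
def Twisted.of [Module K M] : M ≃ₗ[K] Twisted φ M := LinearEquiv.refl K M

theorem Twisted.smul_of [Module K M] [Module A M] (a : A) (m : M) :
    a • Twisted.of φ M m = Twisted.of φ M (φ a • m) := rfl

instance [Module K M] [Module A M] [IsScalarTower K A M] : IsScalarTower K A (Twisted φ M) where
  smul_assoc c a m := by
    change φ (c • a) • (show M from m) = c • (φ a • (show M from m))
    rw [map_smul, smul_assoc]

end Twisted

/-! ### Gelfand–Kirillov dimension -/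

/-- The Gelfand–Kirillov dimension of a (left) module `M` over a `K`-algebra `A`: the supremum,
over all finite-dimensional subspaces `V` of `A` containing `1` and all finite-dimensional
subspaces `F` of `M`, of `limsup_s log (dim_K (V ^ s F)) / log s`. -/
def gkDim (K A M : Type*) [Field K] [Ring A] [Algebra K A] [AddCommGroup M] [Module K M]
    [Module A M] [IsScalarTower K A M] : EReal :=
  ⨆ (V : Submodule K A) (_ : (1 : A) ∈ V) (_ : FiniteDimensional K V)
    (F : Submodule K M) (_ : FiniteDimensional K F),
    Filter.limsup
      (fun s : ℕ =>
        ((Real.log (Module.finrank K (V ^ s • F : Submodule K M)) / Real.log s : ℝ) : EReal))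
      Filter.atTop

/-! ### The Weyl algebra -/

/-- The defining relations of the Weyl algebra, on the free algebra with generators
`x_i` (`Sum.inl i`) and `∂_i` (`Sum.inr i`). -/
inductive WeylRel (K : Type*) [Field K] (n : ℕ) :
    FreeAlgebra K (Fin n ⊕ Fin n) → FreeAlgebra K (Fin n ⊕ Fin n) → Prop
  | x_x (i j : Fin n) : WeylRel K n
      (FreeAlgebra.ι K (Sum.inl i) * FreeAlgebra.ι K (Sum.inl j)
        - FreeAlgebra.ι K (Sum.inl j) * FreeAlgebra.ι K (Sum.inl i)) 0
  | d_d (i j : Fin n) : WeylRel K n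
      (FreeAlgebra.ι K (Sum.inr i) * FreeAlgebra.ι K (Sum.inr j)
        - FreeAlgebra.ι K (Sum.inr j) * FreeAlgebra.ι K (Sum.inr i)) 0
  | d_x (i j : Fin n) : WeylRel K n
      (FreeAlgebra.ι K (Sum.inr i) * FreeAlgebra.ι K (Sum.inl j)
        - FreeAlgebra.ι K (Sum.inl j) * FreeAlgebra.ι K (Sum.inr i)) (if i = j then 1 else 0)

/-- The `n`-th Weyl algebra `A_n` over `K`: the `K`-algebra generated by
`x_1, …, x_n, ∂_1, …, ∂_n` subject to `[x_i, x_j] = [∂_i, ∂_j] = 0`, `[∂_i, x_j] = δ_ij`. -/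
def Weyl (K : Type*) [Field K] (n : ℕ) : Type _ := RingQuot (WeylRel K n)

variable {K : Type*} [Field K] {n : ℕ}

instance : Ring (Weyl K n) := inferInstanceAs (Ring (RingQuot (WeylRel K n)))

instance : Algebra K (Weyl K n) := inferInstanceAs (Algebra K (RingQuot (WeylRel K n)))

namespace Weyl

/-- The generator `x_i`. -/
def x (i : Fin n) : Weyl K n :=
  RingQuot.mkAlgHom K (WeylRel K n) (FreeAlgebra.ι K (Sum.inl i))

/-- The generator `∂_i`. -/
def d (i : Fin n) : Weyl K n :=
  RingQuot.mkAlgHom K (WeylRel K n) (FreeAlgebra.ι K (Sum.inr i))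

theorem x_x (i j : Fin n) : (x i * x j - x j * x i : Weyl K n) = 0 := by
  have h := RingQuot.mkAlgHom_rel K (WeylRel.x_x (K := K) i j)
  rw [map_sub, map_mul, map_mul, map_zero] at h
  exact h

theorem d_d (i j : Fin n) : (d i * d j - d j * d i : Weyl K n) = 0 := by
  have h := RingQuot.mkAlgHom_rel K (WeylRel.d_d (K := K) i j)
  rw [map_sub, map_mul, map_mul, map_zero] at h
  exact h

theorem d_x (i j : Fin n) : (d i * x j - x j * d i : Weyl K n) = if i = j then 1 else 0 := by
  have h := RingQuot.mkAlgHom_rel K (WeylRel.d_x (K := K) i j)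
  rw [map_sub, map_mul, map_mul, apply_ite (RingQuot.mkAlgHom K (WeylRel K n)), map_one,
    map_zero] at h
  exact h

/-- The universal property of the presentation. -/
def lift {B : Type*} [Ring B] [Algebra K B] (a b : Fin n → B)
    (haa : ∀ i j, a i * a j - a j * a i = 0) (hbb : ∀ i j, b i * b j - b j * b i = 0)
    (hba : ∀ i j, b i * a j - a j * b i = if i = j then 1 else 0) : Weyl K n →ₐ[K] B :=
  RingQuot.liftAlgHom K ⟨FreeAlgebra.lift K (Sum.elim a b), by
    rintro _ _ (⟨i, j⟩ | ⟨i, j⟩ | ⟨i, j⟩)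
    · simpa using haa i j
    · simpa using hbb i j
    · rw [apply_ite (FreeAlgebra.lift K (Sum.elim a b))]
      simpa using hba i j⟩

section

variable {B : Type*} [Ring B] [Algebra K B] (a b : Fin n → B)
    (haa : ∀ i j, a i * a j - a j * a i = 0) (hbb : ∀ i j, b i * b j - b j * b i = 0)
    (hba : ∀ i j, b i * a j - a j * b i = if i = j then 1 else 0)

theorem lift_x (i : Fin n) : lift (K := K) a b haa hbb hba (x i) = a i :=
  (RingQuot.liftAlgHom_mkAlgHom_apply K _ _ _).trans (by simp)

theorem lift_d (i : Fin n) : lift (K := K) a b haa hbb hba (d i) = b i :=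
  (RingQuot.liftAlgHom_mkAlgHom_apply K _ _ _).trans (by simp)

end

/-! #### The natural action on polynomials -/

theorem pderiv_comm (i j : Fin n) (p : MvPolynomial (Fin n) K) :
    pderiv i (pderiv j p) = pderiv j (pderiv i p) := by
  let D : Fin n → Derivation K (MvPolynomial (Fin n) K) (MvPolynomial (Fin n) K) := pderiv
  have h : ⁅D i, D j⁆ = 0 := by
    refine MvPolynomial.derivation_ext fun k => ?_
    simp only [D, Derivation.commutator_apply, pderiv_X, Pi.single_apply]
    split_ifs <;> simp
  have h2 : ⁅D i, D j⁆ p = 0 := by rw [h]; rfl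
  rwa [Derivation.commutator_apply, sub_eq_zero] at h2

/-- The natural action of `A_n` on `P_n = K[x_1, …, x_n]`: `x_i` acts by multiplication and `∂_i`
by partial differentiation. -/
def act : Weyl K n →ₐ[K] Module.End K (MvPolynomial (Fin n) K) :=
  lift (fun i => LinearMap.mulLeft K (X i)) (fun i => (pderiv i).toLinearMap)
    (fun i j => by
      refine LinearMap.ext fun p => ?_
      simp only [LinearMap.sub_apply, Module.End.mul_apply, LinearMap.mulLeft_apply,
        LinearMap.zero_apply]
      ring)
    (fun i j => by
      refine LinearMap.ext fun p => ?_
      exact sub_eq_zero.2 (pderiv_comm i j p))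
    (fun i j => by
      refine LinearMap.ext fun p => ?_
      simp only [LinearMap.sub_apply, Module.End.mul_apply, LinearMap.mulLeft_apply,
        Derivation.coeFn_coe, Derivation.leibniz, pderiv_X,
        smul_eq_mul, Pi.single_apply]
      by_cases h : i = j
      · simp [h]
      · simp [h, Ne.symm h])

/-- `P_n` as an `A_n`-module. -/
instance : Module (Weyl K n) (MvPolynomial (Fin n) K) :=
  Module.compHom _ (act (K := K) (n := n)).toRingHom

theorem smul_eq_act (a : Weyl K n) (p : MvPolynomial (Fin n) K) : a • p = act a p := rfl

theorem x_smul (i : Fin n) (p : MvPolynomial (Fin n) K) : (x i : Weyl K n) • p = X i * p := by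
  rw [smul_eq_act, act, lift_x]; rfl

theorem d_smul (i : Fin n) (p : MvPolynomial (Fin n) K) :
    (d i : Weyl K n) • p = pderiv i p := by
  rw [smul_eq_act, act, lift_d]; rfl

instance : IsScalarTower K (Weyl K n) (MvPolynomial (Fin n) K) where
  smul_assoc c a p := by
    simp only [smul_eq_act, map_smul, LinearMap.smul_apply]

/-! #### Polynomials and derivations as elements of the Weyl algebra -/

open scoped IsMulCommutative in
/-- The algebra homomorphism `P_n → A_n` with `x_i ↦ x_i`. -/
def ofPoly : MvPolynomial (Fin n) K →ₐ[K] Weyl K n :=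
  haveI : IsMulCommutative (Algebra.adjoin K (Set.range (x : Fin n → Weyl K n))) :=
    Algebra.isMulCommutative_adjoin K (by
      rintro _ ⟨i, rfl⟩ _ ⟨j, rfl⟩
      exact sub_eq_zero.1 (x_x i j))
  (Subalgebra.val (Algebra.adjoin K (Set.range (x : Fin n → Weyl K n)))).comp
    (MvPolynomial.aeval fun i => (⟨x i, Algebra.subset_adjoin (Set.mem_range_self i)⟩ :
      Algebra.adjoin K (Set.range (x : Fin n → Weyl K n))))

open scoped IsMulCommutative in
theorem ofPoly_X (i : Fin n) : ofPoly (X i : MvPolynomial (Fin n) K) = x i := by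
  simp [ofPoly]

theorem ofPoly_smul (p q : MvPolynomial (Fin n) K) : ofPoly p • q = p * q := by
  induction p using MvPolynomial.induction_on generalizing q with
  | C c =>
    rw [← algebraMap_eq, AlgHom.commutes, algebraMap_smul, algebraMap_eq, C_mul']
  | add p r hp hr => rw [map_add, add_smul, hp, hr, add_mul]
  | mul_X p i hp => rw [map_mul, mul_smul, ofPoly_X, x_smul, hp, mul_assoc]

theorem ofPoly_comm (p q : MvPolynomial (Fin n) K) :
    (ofPoly p * ofPoly q : Weyl K n) = ofPoly q * ofPoly p := by
  rw [← map_mul, mul_comm, map_mul]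

/-- The derivation `D = ∑ D(x_j) ∂_j` of `P_n` as an element of `A_n`. -/
def ofDer (D : Derivation K (MvPolynomial (Fin n) K) (MvPolynomial (Fin n) K)) : Weyl K n :=
  ∑ j, ofPoly (D (X j)) * d j

theorem ofDer_smul (D : Derivation K (MvPolynomial (Fin n) K) (MvPolynomial (Fin n) K))
    (p : MvPolynomial (Fin n) K) : ofDer D • p = D p := by
  simp only [ofDer, Finset.sum_smul, mul_smul, ofPoly_smul, d_smul]
  induction p using MvPolynomial.induction_on with
  | C c => simp [derivation_C]
  | add p q hp hq => simp only [map_add, mul_add, Finset.sum_add_distrib, hp, hq]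
  | mul_X p i hp =>
    have h : ∑ j, D (X j) * pderiv j (X i : MvPolynomial (Fin n) K) = D (X i) := by
      simp [pderiv_X, Pi.single_apply]
    simp only [Derivation.leibniz, smul_eq_mul, mul_add, Finset.sum_add_distrib]
    rw [← hp, ← h, Finset.mul_sum, Finset.mul_sum]
    congr 1 <;> exact Finset.sum_congr rfl fun j _ => mul_left_comm _ _ _

theorem d_ofPoly (i : Fin n) (p : MvPolynomial (Fin n) K) :
    (d i * ofPoly p : Weyl K n) = ofPoly p * d i + ofPoly (pderiv i p) := by
  induction p using MvPolynomial.induction_on with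
  | C c =>
    rw [pderiv_C, map_zero, add_zero, ← algebraMap_eq, AlgHom.commutes]
    exact (Algebra.commutes c _).symm
  | add p q hp hq => simp only [map_add, mul_add, add_mul, hp, hq]; abel
  | mul_X p j hp =>
    have h : (d i * x j : Weyl K n) = x j * d i + if i = j then 1 else 0 := by
      rw [← d_x]; abel
    have h2 : (ofPoly (pderiv i (X j : MvPolynomial (Fin n) K)) : Weyl K n)
        = if i = j then 1 else 0 := by
      rw [pderiv_X, Pi.single_apply]
      by_cases hij : i = j
      · simp [hij]
      · simp [hij, Ne.symm hij]
    rw [map_mul, ← mul_assoc, hp, add_mul, mul_assoc, ofPoly_X, h, Derivation.leibniz,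
      smul_eq_mul, smul_eq_mul, map_add, map_mul, map_mul, h2, ofPoly_X, mul_add, ← mul_assoc,
      ← ofPoly_X, ofPoly_comm (X j)]
    abel

theorem ofDer_ofPoly (D : Derivation K (MvPolynomial (Fin n) K) (MvPolynomial (Fin n) K))
    (p : MvPolynomial (Fin n) K) :
    ofDer D * ofPoly p - ofPoly p * ofDer D = (ofPoly (D p) : Weyl K n) := by
  rw [← ofDer_smul D p, ofDer]
  simp only [Finset.sum_mul, Finset.mul_sum, Finset.sum_smul, mul_smul, ofPoly_smul, d_smul,
    map_sum, ← Finset.sum_sub_distrib]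
  refine Finset.sum_congr rfl fun j _ => ?_
  rw [mul_assoc, d_ofPoly, mul_add, ← mul_assoc, ofPoly_comm _ p, ← mul_assoc, map_mul]
  abel

theorem ofDer_ofDer (D E : Derivation K (MvPolynomial (Fin n) K) (MvPolynomial (Fin n) K)) :
    ofDer D * ofDer E - ofDer E * ofDer D = (ofDer ⁅D, E⁆ : Weyl K n) := by
  have key : ∀ D E : Derivation K (MvPolynomial (Fin n) K) (MvPolynomial (Fin n) K),
      (ofDer D * ofDer E : Weyl K n) = ∑ j, ofPoly (D (E (X j))) * d j
        + ∑ j, ∑ k, ofPoly (E (X j)) * ofPoly (D (X k)) * (d k * d j) := by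
    intro D E
    conv_lhs => rw [ofDer.eq_def E]
    rw [Finset.mul_sum, ← Finset.sum_add_distrib]
    refine Finset.sum_congr rfl fun j _ => ?_
    have h := ofDer_ofPoly D (E (X j))
    rw [sub_eq_iff_eq_add] at h
    rw [← mul_assoc, h, add_mul, ofDer, Finset.mul_sum, Finset.sum_mul]
    simp only [mul_assoc]
  rw [key D E, key E D, Finset.sum_comm (f := fun j k =>
    ofPoly (D (X j)) * ofPoly (E (X k)) * (d k * d j))]
  have h2 : ∀ j k : Fin n, (ofPoly (D (X k)) * ofPoly (E (X j)) * (d j * d k) : Weyl K n)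
      = ofPoly (E (X j)) * ofPoly (D (X k)) * (d k * d j) := fun j k => by
    rw [ofPoly_comm, sub_eq_zero.1 (d_d j k)]
  simp only [h2, ofDer, Derivation.commutator_apply, map_sub, sub_mul, Finset.sum_sub_distrib]
  abel

end Weyl

/-- An `A_n`-module is holonomic if it is finitely generated of Gelfand–Kirillov dimension `n`. -/
def IsHolonomic (K : Type*) [Field K] (n : ℕ) (M : Type*) [AddCommGroup M] [Module K M]
    [Module (Weyl K n) M] [IsScalarTower K (Weyl K n) M] : Prop :=
  Module.Finite (Weyl K n) M ∧ gkDim K (Weyl K n) M = (n : EReal)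

/-! ### Jacobian maps and their extension to the Weyl algebra -/

variable (σ : MvPolynomial (Fin n) K →ₐ[K] MvPolynomial (Fin n) K)

/-- The Jacobian matrix `(∂ p_i / ∂ x_j)` of polynomials `p_1, …, p_n`. -/
def jacobianMatrix (p : Fin n → MvPolynomial (Fin n) K) :
    Matrix (Fin n) (Fin n) (MvPolynomial (Fin n) K) :=
  Matrix.of fun i j => pderiv j (p i)

/-- The Jacobian determinant of the endomorphism `σ` of `P_n`. -/
def jacobian : MvPolynomial (Fin n) K := (jacobianMatrix fun i => σ (X i)).det

/-- `σ` is a Jacobian map: its Jacobian determinant is a nonzero scalar. -/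
def IsJacobianMap : Prop := ∃ c : K, c ≠ 0 ∧ jacobian σ = C c

/-- The degree of `σ`: the maximum of the degrees of the polynomials `σ(x_i)`. -/
def endDegree : ℕ := Finset.univ.sup fun i => (σ (X i)).totalDegree

theorem jacobianMatrix_update (p : Fin n → MvPolynomial (Fin n) K) (i : Fin n)
    (q : MvPolynomial (Fin n) K) :
    jacobianMatrix (Function.update p i q)
      = (jacobianMatrix p).updateRow i fun j => pderiv j q := by
  ext1 k j
  by_cases h : k = i
  · subst h; simp [jacobianMatrix]
  · simp [jacobianMatrix, Matrix.updateRow_ne h, Function.update_of_ne h]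

/-- The derivation `∂_i'` of `P_n` attached to `σ`:
`∂_i'(p) = det 𝒥(σ)⁻¹ · det 𝒥(σ(x_1), …, σ(x_{i-1}), p, σ(x_{i+1}), …, σ(x_n))`. -/
def derPrime (i : Fin n) : Derivation K (MvPolynomial (Fin n) K) (MvPolynomial (Fin n) K) :=
  Derivation.mk'
    { toFun := fun p => Ring.inverse (jacobian σ) *
        (jacobianMatrix (Function.update (fun k => σ (X k)) i p)).det
      map_add' := fun p q => by
        simp only [jacobianMatrix_update]
        rw [← mul_add, ← Matrix.det_updateRow_add]
        congr 3
        ext1 j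
        simp
      map_smul' := fun c p => by
        simp only [jacobianMatrix_update, RingHom.id_apply, smul_eq_C_mul]
        rw [mul_left_comm]
        congr 1
        rw [← Matrix.det_updateRow_smul]
        congr 2
        ext1 j
        simp [Derivation.leibniz] }
    (fun p q => by
      simp only [LinearMap.coe_mk, AddHom.coe_mk, jacobianMatrix_update, smul_eq_mul]
      rw [mul_left_comm p, mul_left_comm q, ← mul_add]
      congr 1
      rw [← Matrix.det_updateRow_smul, ← Matrix.det_updateRow_smul, ← Matrix.det_updateRow_add]
      congr 2
      ext1 j
      simp [Derivation.leibniz])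

theorem derPrime_apply (i : Fin n) (p : MvPolynomial (Fin n) K) :
    derPrime σ i p = Ring.inverse (jacobian σ) *
      (jacobianMatrix (Function.update (fun k => σ (X k)) i p)).det := rfl

variable {σ}

theorem IsJacobianMap.isUnit (hσ : IsJacobianMap σ) : IsUnit (jacobian σ) := by
  obtain ⟨c, hc, h⟩ := hσ
  rw [h]
  exact (isUnit_iff_ne_zero.2 hc).map C

theorem IsJacobianMap.derPrime_X (hσ : IsJacobianMap σ) (i j : Fin n) :
    derPrime σ i (σ (X j)) = if i = j then 1 else 0 := by
  rw [derPrime_apply]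
  by_cases h : i = j
  · subst h
    rw [if_pos rfl, Function.update_eq_self_iff.2 rfl]
    exact Ring.inverse_mul_cancel _ hσ.isUnit
  · rw [if_neg h, Matrix.det_zero_of_row_eq h, mul_zero]
    ext1 k
    simp [jacobianMatrix, Function.update_of_ne (Ne.symm h)]

/-- A derivation that kills all `σ(x_i)` is zero. -/
theorem IsJacobianMap.der_eq_zero (hσ : IsJacobianMap σ)
    (D : Derivation K (MvPolynomial (Fin n) K) (MvPolynomial (Fin n) K))
    (hD : ∀ i, D (σ (X i)) = 0) : D = 0 := by
  have h : (jacobianMatrix fun i => σ (X i)).mulVec (fun j => D (X j)) = 0 := by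
    ext1 i
    have := hD i
    rw [← Weyl.ofDer_smul D] at this
    simp only [Weyl.ofDer, Finset.sum_smul, mul_smul, Weyl.ofPoly_smul, Weyl.d_smul] at this
    simpa [Matrix.mulVec, dotProduct, jacobianMatrix, mul_comm] using this
  have hu : IsUnit (jacobianMatrix fun i => σ (X i)) :=
    (Matrix.isUnit_iff_isUnit_det _).2 hσ.isUnit
  have h0 := Matrix.mulVec_injective_of_isUnit hu (h.trans (Matrix.mulVec_zero _).symm)
  ext1 j
  simpa using congrFun h0 j

theorem IsJacobianMap.derPrime_comm (hσ : IsJacobianMap σ) (i j : Fin n) :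
    ⁅derPrime σ i, derPrime σ j⁆ = 0 := by
  refine hσ.der_eq_zero _ fun k => ?_
  rw [Derivation.commutator_apply, hσ.derPrime_X, hσ.derPrime_X]
  split_ifs <;> simp

/-- The extension of a Jacobian map `σ` of `P_n` to an endomorphism of `A_n`:
`x_i ↦ σ(x_i)`, `∂_i ↦ ∂_i'`. -/
def IsJacobianMap.extend (hσ : IsJacobianMap σ) : Weyl K n →ₐ[K] Weyl K n :=
  Weyl.lift (fun i => Weyl.ofPoly (σ (X i))) (fun i => Weyl.ofDer (derPrime σ i))
    (fun i j => by rw [Weyl.ofPoly_comm, sub_self])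
    (fun i j => by rw [Weyl.ofDer_ofDer, hσ.derPrime_comm]; simp [Weyl.ofDer])
    (fun i j => by rw [Weyl.ofDer_ofPoly, hσ.derPrime_X]; split_ifs <;> simp)

theorem IsJacobianMap.extend_x (hσ : IsJacobianMap σ) (i : Fin n) :
    hσ.extend (Weyl.x i) = Weyl.ofPoly (σ (X i)) := Weyl.lift_x _ _ _ _ _ i

theorem IsJacobianMap.extend_d (hσ : IsJacobianMap σ) (i : Fin n) :
    hσ.extend (Weyl.d i) = Weyl.ofDer (derPrime σ i) := Weyl.lift_d _ _ _ _ _ i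

/-- On the twisted module `^σ P_n`, `x_i` acts by multiplication by `σ(x_i)`. -/
theorem IsJacobianMap.x_smul_twisted (hσ : IsJacobianMap σ) (i : Fin n)
    (p : MvPolynomial (Fin n) K) :
    (Weyl.x i : Weyl K n) • Twisted.of hσ.extend _ p = Twisted.of hσ.extend _ (σ (X i) * p) := by
  rw [Twisted.smul_of, hσ.extend_x, Weyl.ofPoly_smul]

/-- On the twisted module `^σ P_n`, `∂_i` acts by `∂_i'`. -/
theorem IsJacobianMap.d_smul_twisted (hσ : IsJacobianMap σ) (i : Fin n)
    (p : MvPolynomial (Fin n) K) :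
    (Weyl.d i : Weyl K n) • Twisted.of hσ.extend _ p
      = Twisted.of hσ.extend _ (derPrime σ i p) := by
  rw [Twisted.smul_of, hσ.extend_d, Weyl.ofDer_smul]

end JacWeyl

end

/-!
The twisted module `^σ P_n` is filtered by the degree of polynomials. The generators of the Weyl
algebra raise the degree by at most `m = max d ((n - 1) (d - 1) - 1)`, because `∂_i'` is a scalar
multiple of a determinant with `n - 1` rows of first derivatives of the `σ(x_k)`. The `t`-th step
has dimension `binom (t + n) n`. Everything except the length bound for `d = 2` follows from the
existence of such a filtration (`Weyl.IsDegreeFiltration`) and Bernstein's inequality.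

A sharp form of that inequality is needed, `Weyl.choose_le_finrank_orbit`: if
`u ≠ 0` belongs to any module over the Weyl algebra, then the operators of order at most `s` (in
`x` and `∂` together) applied to `u` span a space of dimension at least `binom (s + n) n`. Its proof
avoids Hilbert polynomials. Applying the monomials `x^α ∂^β` to `u` in degree-lexicographic order and
discarding those that depend on earlier ones leaves a set of exponents in `ℕ^(2n)` that is closed
under passing to divisors (`exists_isLowerSet_finrank_eq`). Either this set contains a coordinate
cone of dimension `n`, which gives the bound at once, or it grows at most like `s ^ (n - 1)`
(`exists_ncard_inter_le`). The latter is impossible: operators of order at most `s` act faithfully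
on the span of the operators of order at most `s` applied to `u`, since commutators with the
generators differentiate symbols (`Weyl.exists_quantize_mul_smul_ne_zero`), so that the product of
the dimensions for `s` and `2 s` is at least `binom (s + 2n) (2n)`.

* Length. In a chain of `l` strict inclusions each step contributes at least `binom (s + n) n` to
  the dimension of the `(m s + c)`-th step of the filtration; letting `s` grow gives `l ≤ m ^ n`.
* Gelfand–Kirillov dimension. The filtration gives the upper bound, Bernstein's inequality the lower.
* Cyclicity. By dimension every element is killed by a nonzero operator, while no nonzero operator
  kills a nonzero module; this suffices to lift a generator through a chain of finite length
  (`Weyl.exists_span_singleton_eq_top`).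

The number `m` is at most `max d ((d - 1) ^ (n - 1) - 1)` unless `d = 2`. In that case `σ` is an
automorphism by a theorem of Wang (`IsJacobianMap.surjective_of_endDegree_le_two`), and the module
is simple. Here, by the exact midpoint rule `F(f) - F(g) = F'((f + g) / 2) (f - g)` in the tensor
square of `Frac P_n` over `Frac σ(P_n)`, the `x_i` lie in `Frac σ(P_n)`; as `P_n` is étale, hence
flat, over `σ(P_n)`, the reduced denominator of `x_i` is a unit of `P_n`, that is, a constant.
-/

namespace JacWeyl

/-! ### Counting exponent vectors -/

section Counting

open Finset

variable {ι : Type*} [Fintype ι]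

/-- The exponent vectors of degree at most `s` supported in `T`. -/
def expsOn (T : Finset ι) (s : ℕ) : Set (ι →₀ ℕ) := {a | a.support ⊆ T ∧ a.degree ≤ s}

theorem finite_expsOn (T : Finset ι) (s : ℕ) : (expsOn T s).Finite :=
  (Finsupp.finite_of_degree_le s).subset fun _ h => h.2

theorem ncard_expsOn (T : Finset ι) (s : ℕ) : (expsOn T s).ncard = (s + #T).choose s := by
  classical
  induction s with
  | zero =>
    have : expsOn T 0 = {0} := by
      ext a
      simp only [expsOn, Set.mem_ofPred_eq, Nat.le_zero, Finsupp.degree_eq_zero_iff,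
        Set.mem_singleton_iff]
      refine ⟨fun h => h.2, fun h => ?_⟩
      subst h
      simp
    simp [this]
  | succ s ih =>
    have h : expsOn T (s + 1) = expsOn T s ∪ (T.finsuppAntidiag (s + 1) : Finset (ι →₀ ℕ)) := by
      ext a
      simp only [expsOn, Set.mem_union, Set.mem_ofPred_eq, Finset.mem_coe, mem_finsuppAntidiag]
      have hd (h : a.support ⊆ T) : a.degree = T.sum a := by
        rw [Finsupp.degree_apply]
        exact Finset.sum_subset h (by simp)
      constructor
      · rintro ⟨h1, h2⟩
        rcases Nat.lt_or_ge a.degree (s + 1) with h3 | h3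
        · exact Or.inl ⟨h1, by omega⟩
        · exact Or.inr ⟨by rw [← hd h1]; omega, h1⟩
      · rintro (⟨h1, h2⟩ | ⟨h1, h2⟩)
        · exact ⟨h1, by omega⟩
        · exact ⟨h2, by rw [hd h2]; omega⟩
    rw [h, Set.ncard_union_eq _ (finite_expsOn T s) (Finset.finite_toSet _), ih,
      Set.ncard_coe_finset, card_finsuppAntidiag_nat_eq_choose]
    · rw [show #T + (s + 1) - 1 = s + #T by omega, show s + 1 + #T = s + #T + 1 by omega,
        Nat.choose_succ_succ]
    · rw [Set.disjoint_left]
      rintro a ⟨h1, h2⟩ h3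
      rw [Finset.mem_coe, mem_finsuppAntidiag] at h3
      have : a.degree = T.sum a := by
        rw [Finsupp.degree_apply]
        exact Finset.sum_subset h1 (by simp)
      omega

theorem ncard_degree_le (s : ℕ) :
    {a : ι →₀ ℕ | a.degree ≤ s}.ncard = (s + Fintype.card ι).choose s := by
  have h := ncard_expsOn (Finset.univ : Finset ι) s
  rwa [show expsOn Finset.univ s = {a : ι →₀ ℕ | a.degree ≤ s} by simp [expsOn]] at h

/-- A set of exponent vectors that is closed under passing to divisors and contains no coordinate
cone of dimension `r + 1` grows at most like a polynomial of degree `r`: all but at most `r`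
coordinates of each of its elements are bounded by a constant. -/
theorem exists_ncard_inter_le (S : Set (ι →₀ ℕ)) (hS : IsLowerSet S) (r : ℕ)
    (h : ∀ T : Finset ι, #T = r + 1 → ∃ a : ι →₀ ℕ, a.support ⊆ T ∧ a ∉ S) :
    ∃ C : ℕ, ∀ s, (S ∩ {a | a.degree ≤ s}).ncard ≤ C * (s + 1) ^ r := by
  classical
  choose! v hv hvS using h
  set M : ℕ := ∑ T : Finset ι, ∑ i, v T i with hM
  have hvM (T : Finset ι) (i : ι) : v T i ≤ M :=
    (Finset.single_le_sum (f := fun i => v T i) (fun _ _ => Nat.zero_le _) (mem_univ i)).trans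
      (Finset.single_le_sum (f := fun T => ∑ i, v T i) (fun _ _ => Nat.zero_le _) (mem_univ T))
  -- Otherwise `a` would be a multiple of some excluded `v T`.
  have hbig (a) (ha : a ∈ S) : #{i | M ≤ a i} ≤ r := by
    by_contra! hlt
    obtain ⟨T, hT, hTc⟩ := Finset.exists_subset_card_eq (Nat.succ_le_of_lt hlt)
    refine hvS T hTc (hS (fun i => ?_) ha)
    by_cases hi : i ∈ T
    · exact (hvM T i).trans (mem_filter.1 (hT hi)).2
    · rw [Finsupp.notMem_support_iff.1 fun h => hi (hv T hTc h)]
      exact Nat.zero_le _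
  let box (s : ℕ) (T : Finset ι) : Finset (ι → ℕ) :=
    Fintype.piFinset fun i => if i ∈ T then range (s + 1) else range (M + 1)
  have hbox (s : ℕ) (T : Finset ι) (hT : #T ≤ r) :
      #(box s T) ≤ (M + 1) ^ Fintype.card ι * (s + 1) ^ r := by
    have h1 : ∏ i, (if i ∈ T then (s + 1) else 1) = (s + 1) ^ #T := by
      rw [Finset.prod_ite_mem, Finset.univ_inter, Finset.prod_const]
    calc #(box s T) = ∏ i, (if i ∈ T then (s + 1) else (M + 1)) := by
            simp only [box, Fintype.card_piFinset]
            exact Finset.prod_congr rfl fun i _ => by split_ifs <;> simp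
      _ ≤ ∏ i, ((M + 1) * (if i ∈ T then (s + 1) else 1)) := by
            refine Finset.prod_le_prod' fun i _ => ?_
            split_ifs
            · exact Nat.le_mul_of_pos_left _ (by omega)
            · simp
      _ = (M + 1) ^ Fintype.card ι * (s + 1) ^ #T := by
            rw [Finset.prod_mul_distrib, h1, Finset.prod_const, Finset.card_univ]
      _ ≤ _ := Nat.mul_le_mul_left _ (Nat.pow_le_pow_right (by omega) hT)
  refine ⟨2 ^ Fintype.card ι * (M + 1) ^ Fintype.card ι, fun s => ?_⟩
  let U : Finset (ι → ℕ) := (Finset.univ.filter fun T : Finset ι => #T ≤ r).biUnion (box s)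
  have hU : #U ≤ 2 ^ Fintype.card ι * ((M + 1) ^ Fintype.card ι * (s + 1) ^ r) := by
    refine (Finset.card_biUnion_le_card_mul _ _ _ fun T hT => hbox s T (mem_filter.1 hT).2).trans
      (Nat.mul_le_mul_right _ ?_)
    refine (Finset.card_filter_le _ _).trans ?_
    rw [Finset.card_univ, Fintype.card_finset]
  rw [mul_assoc]
  refine le_trans ?_ hU
  rw [← Set.ncard_coe_finset U]
  refine Set.ncard_le_ncard_of_injOn (fun a i => a i) ?_ ?_ U.finite_toSet
  · rintro a ⟨ha, hs⟩
    simp only [U, Finset.coe_biUnion, Set.mem_iUnion, Finset.mem_coe, mem_filter]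
    refine ⟨({i | M ≤ a i} : Finset ι), ⟨mem_univ _, hbig a ha⟩, ?_⟩
    rw [Fintype.mem_piFinset]
    intro i
    have hi : a i ≤ s := (Finsupp.le_degree i a).trans hs
    split_ifs with h
    · exact mem_range.2 (by omega)
    · simp only [mem_filter, mem_univ, true_and, not_le] at h
      exact mem_range.2 (by omega)
  · intro a _ b _ hab
    exact DFunLike.coe_injective hab

end Counting

end JacWeyl

namespace JacWeyl

/-! ### Standard indices of a family of vectors -/

section Standard

variable {K V : Type*} [Field K] [AddCommGroup V] [Module K V]

section Order

variable {I : Type*} [LinearOrder I]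

variable (K) in
/-- The standard indices of a family of vectors: those whose vector is not a linear combination of
the vectors with smaller index. -/
def standardIndices (v : I → V) : Set I :=
  {i | v i ∉ Submodule.span K (v '' Set.Iio i)}

theorem linearIndepOn_standardIndices (v : I → V) (s : Finset I)
    (hs : (s : Set I) ⊆ standardIndices K v) : LinearIndepOn K v (s : Set I) := by
  classical
  induction s using Finset.induction_on_max with
  | empty => simp
  | insert a s ha ih =>
    rw [Finset.coe_insert] at hs ⊢
    refine (ih ((Set.subset_insert _ _).trans hs)).insert fun hmem => ?_
    exact hs (Set.mem_insert _ _) (Submodule.span_mono (Set.image_mono fun b hb => ha b hb) hmem)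

theorem span_image_standardIndices [WellFoundedLT I] (v : I → V) {J : Set I} (hJ : IsLowerSet J) :
    Submodule.span K (v '' (J ∩ standardIndices K v)) = Submodule.span K (v '' J) := by
  refine le_antisymm (Submodule.span_mono (Set.image_mono Set.inter_subset_left)) ?_
  rw [Submodule.span_le]
  rintro _ ⟨i, hi, rfl⟩
  induction i using WellFoundedLT.induction with
  | ind i ih =>
    by_cases hs : i ∈ standardIndices K v
    · exact Submodule.subset_span ⟨i, ⟨hi, hs⟩, rfl⟩
    · have h : v i ∈ Submodule.span K (v '' Set.Iio i) := not_not.1 hs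
      refine Submodule.span_le.2 ?_ h
      rintro _ ⟨j, hj, rfl⟩
      exact ih j hj (hJ (le_of_lt hj) hi)

theorem finrank_span_image_eq_ncard [WellFoundedLT I] (v : I → V) {J : Set I} (hJ : IsLowerSet J)
    (hfin : J.Finite) :
    Module.finrank K (Submodule.span K (v '' J)) = (J ∩ standardIndices K v).ncard := by
  classical
  have hf : (J ∩ standardIndices K v).Finite := hfin.inter_of_left _
  rw [← span_image_standardIndices v hJ]
  have hli := linearIndepOn_standardIndices (K := K) v hf.toFinset (by simp)
  rw [hf.coe_toFinset] at hli
  have := hf.fintype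
  have h := finrank_span_eq_card (R := K) hli
  rw [Set.ncard_eq_toFinset_card', Set.toFinset_card, ← h, Set.image_eq_range]

end Order

theorem exponent_induction {ι : Type*} {P : (ι →₀ ℕ) → Prop} (a : ι →₀ ℕ) (zero : P 0)
    (add_single : ∀ a i, P a → P (a + Finsupp.single i 1)) : P a := by
  induction a using Finsupp.induction with
  | zero => exact zero
  | single_add i m f _ _ ih =>
    clear * - ih add_single
    induction m with
    | zero => simpa using ih
    | succ m hm =>
      rw [Finsupp.single_add, add_right_comm]
      exact add_single _ _ hm

variable {ι : Type*}

/-- A family of vectors indexed by exponent vectors, and operators that raise an exponent by one up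
to terms of no larger degree, behave like the monomials in a cyclic module over a polynomial ring:
the dimension of the span of the vectors of degree at most `s` is the number of exponent vectors of
degree at most `s` in a set closed under passing to divisors. -/
theorem exists_isLowerSet_finrank_eq [Finite ι] (v : (ι →₀ ℕ) → V) (g : ι → V →ₗ[K] V)
    (hg : ∀ i a, g i (v a) - v (a + Finsupp.single i 1) ∈
      Submodule.span K (v '' {b | b.degree ≤ a.degree})) :
    ∃ S : Set (ι →₀ ℕ), IsLowerSet S ∧ ∀ s : ℕ,
      Module.finrank K (Submodule.span K (v '' {a | a.degree ≤ s}))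
        = (S ∩ {a | a.degree ≤ s}).ncard := by
  classical
  cases nonempty_fintype ι
  -- Any order of the variables will do.
  let : LinearOrder ι := LinearOrder.lift' (Fintype.equivFin ι) (Equiv.injective _)
  let w : DegLex (ι →₀ ℕ) → V := fun a => v (ofDegLex a)
  have hlow (s : ℕ) : IsLowerSet {a : DegLex (ι →₀ ℕ) | (ofDegLex a).degree ≤ s} :=
    fun a b hab ha => (Finsupp.DegLex.monotone_degree hab).trans ha
  refine ⟨toDegLex ⁻¹' standardIndices K w, ?_, fun s => ?_⟩
  · have step (a : ι →₀ ℕ) (i : ι) (h : toDegLex (a + Finsupp.single i 1) ∈ standardIndices K w) :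
        toDegLex a ∈ standardIndices K w := by
      by_contra hna
      have hna : v a ∈ Submodule.span K (w '' Set.Iio (toDegLex a)) := not_not.1 hna
      -- The error terms in `hg` have smaller degree than the raised exponent, hence are smaller.
      have hsmall (b : ι →₀ ℕ) (hb : b.degree ≤ a.degree) :
          v '' {c | c.degree ≤ b.degree} ⊆
            w '' Set.Iio (toDegLex (a + Finsupp.single i 1)) := by
        rintro _ ⟨c, hc, rfl⟩
        refine ⟨toDegLex c, ?_, rfl⟩
        rw [Set.mem_Iio, Finsupp.DegLex.lt_iff]
        left
        have hc' : c.degree ≤ b.degree := hc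
        simp only [ofDegLex_toDegLex, map_add, Finsupp.degree_single]
        omega
      have key : g i (v a) ∈
          Submodule.span K (w '' Set.Iio (toDegLex (a + Finsupp.single i 1))) := by
        have h1 := Submodule.mem_map_of_mem (f := g i) hna
        rw [Submodule.map_span] at h1
        refine Submodule.span_le.2 ?_ h1
        rintro _ ⟨_, ⟨b, hb, rfl⟩, rfl⟩
        have hb' : (ofDegLex b).degree ≤ a.degree :=
          Finsupp.DegLex.monotone_degree (le_of_lt hb)
        have h2 := Submodule.span_mono (R := K) (hsmall _ hb') (hg i (ofDegLex b))
        have h3 : v (ofDegLex b + Finsupp.single i 1) ∈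
            Submodule.span K (w '' Set.Iio (toDegLex (a + Finsupp.single i 1))) := by
          refine Submodule.subset_span ⟨toDegLex (ofDegLex b + Finsupp.single i 1), ?_, rfl⟩
          rw [Set.mem_Iio, toDegLex_add, toDegLex_add]
          exact add_lt_add_left hb _
        simpa using add_mem h2 h3
      have h4 := sub_mem key (Submodule.span_mono (R := K) (hsmall a le_rfl) (hg i a))
      rw [sub_sub_cancel] at h4
      exact h h4
    intro b a hab hb
    obtain ⟨c, rfl⟩ := le_iff_exists_add.1 hab
    clear hab
    induction c using exponent_induction with
    | zero => simpa using hb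
    | add_single c i ih =>
      rw [← add_assoc] at hb
      exact ih (step _ _ hb)
  · have h := finrank_span_image_eq_ncard (K := K) w (hlow s)
      (Finsupp.finite_of_degree_le (σ := ι) s)
    rw [Set.inter_comm] at h
    exact h

end Standard

end JacWeyl

noncomputable section

namespace JacWeyl

open MvPolynomial

/-! ### Normally ordered symbols -/

section Commuting

variable {K A τ : Type*} [CommRing K] [Ring A] [Algebra K A]

open scoped IsMulCommutative in
/-- Evaluation of polynomials at a family of pairwise commuting elements of an algebra that need
not be commutative. -/
def commAeval (c : τ → A) (hc : ∀ i j, c i * c j = c j * c i) : MvPolynomial τ K →ₐ[K] A :=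
  haveI : IsMulCommutative (Algebra.adjoin K (Set.range c)) :=
    Algebra.isMulCommutative_adjoin K (by rintro _ ⟨i, rfl⟩ _ ⟨j, rfl⟩; exact hc i j)
  (Subalgebra.val (Algebra.adjoin K (Set.range c))).comp
    (MvPolynomial.aeval fun i => (⟨c i, Algebra.subset_adjoin (Set.mem_range_self i)⟩ :
      Algebra.adjoin K (Set.range c)))

open scoped IsMulCommutative in
@[simp] theorem commAeval_X (c : τ → A) (hc : ∀ i j, c i * c j = c j * c i) (i : τ) :
    commAeval (K := K) c hc (X i) = c i := by
  simp [commAeval]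

end Commuting

section Degree

variable {K τ : Type*} [Field K]

theorem totalDegree_X_mul_le (i : τ) (w : MvPolynomial τ K) :
    (X i * w).totalDegree ≤ w.totalDegree + 1 := by
  refine (totalDegree_mul _ _).trans ?_
  rw [totalDegree_X]; omega

theorem totalDegree_pderiv_le (i : τ) (w : MvPolynomial τ K) :
    (pderiv i w).totalDegree ≤ w.totalDegree - 1 := by
  classical
  conv_lhs => rw [w.as_sum, map_sum]
  refine (totalDegree_finsetSum _ _).trans (Finset.sup_le fun a ha => ?_)
  rw [pderiv_monomial]
  by_cases h : coeff a w * (a i : K) = 0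
  · rw [h]; simp
  have hi : a i ≠ 0 := fun h0 => h (by simp [h0])
  refine (totalDegree_monomial_le _ _).trans ?_
  have h1 := le_totalDegree ha
  change Finsupp.degree a ≤ _ at h1
  change Finsupp.degree (a - Finsupp.single i 1) ≤ _
  have h2 : a - Finsupp.single i 1 + Finsupp.single i 1 = a :=
    tsub_add_cancel_of_le (Finsupp.single_le_iff.2 (Nat.one_le_iff_ne_zero.2 hi))
  have h3 := congrArg Finsupp.degree h2
  rw [map_add, Finsupp.degree_single] at h3
  omega

end Degree

namespace Weyl

variable {K : Type*} [Field K] {n : ℕ}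

/-- The pairwise commuting operators on `A_n` given by left multiplication by the `x_i` and right
multiplication by the `∂_i`. -/
def normalOp : Fin n ⊕ Fin n → Module.End K (Weyl K n) :=
  Sum.elim (fun i => LinearMap.mulLeft K (x i)) (fun i => LinearMap.mulRight K (d i))

theorem normalOp_comm (i j : Fin n ⊕ Fin n) :
    (normalOp i * normalOp j : Module.End K (Weyl K n)) = normalOp j * normalOp i := by
  refine LinearMap.ext fun a => ?_
  rcases i with i | i <;> rcases j with j | j <;>
    simp only [normalOp, Sum.elim_inl, Sum.elim_inr, Module.End.mul_apply,
      LinearMap.mulLeft_apply, LinearMap.mulRight_apply]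
  · rw [← mul_assoc, ← mul_assoc, sub_eq_zero.1 (x_x i j)]
  · rw [mul_assoc]
  · rw [mul_assoc]
  · rw [mul_assoc, mul_assoc, sub_eq_zero.1 (d_d j i)]

/-- The normally ordered element of `A_n` with a given symbol: a polynomial in the commuting
variables `x_1, …, x_n` (`Sum.inl i`) and `ξ_1, …, ξ_n` (`Sum.inr i`) is sent to the element
obtained by writing `∂_i` for `ξ_i`, with all `∂_i` to the right of all `x_j`. -/
def quantize : MvPolynomial (Fin n ⊕ Fin n) K →ₗ[K] Weyl K n :=
  (LinearMap.applyₗ (1 : Weyl K n)).comp (commAeval normalOp normalOp_comm).toLinearMap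

theorem quantize_apply (w : MvPolynomial (Fin n ⊕ Fin n) K) :
    quantize w = commAeval (K := K) normalOp normalOp_comm w 1 := rfl

@[simp] theorem quantize_one : quantize (1 : MvPolynomial (Fin n ⊕ Fin n) K) = 1 := by
  rw [quantize_apply, map_one (commAeval _ _)]; rfl

theorem quantize_C (c : K) : quantize (C c : MvPolynomial (Fin n ⊕ Fin n) K) = algebraMap K _ c := by
  rw [← mul_one (C c), ← smul_eq_C_mul, map_smul, quantize_one, Algebra.algebraMap_eq_smul_one]

theorem quantize_X_inl_mul (i : Fin n) (w : MvPolynomial (Fin n ⊕ Fin n) K) :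
    quantize (X (Sum.inl i) * w) = x i * quantize w := by
  rw [quantize_apply, map_mul, commAeval_X]; rfl

theorem quantize_X_inr_mul (i : Fin n) (w : MvPolynomial (Fin n ⊕ Fin n) K) :
    quantize (X (Sum.inr i) * w) = quantize w * d i := by
  rw [quantize_apply, map_mul, commAeval_X]; rfl

theorem d_mul_x (i j : Fin n) : (d i * x j : Weyl K n) = x j * d i + if i = j then 1 else 0 := by
  rw [← d_x]; abel

/-- Commutation with `∂_i` differentiates the symbol with respect to `x_i`. -/
theorem d_mul_quantize (i : Fin n) (w : MvPolynomial (Fin n ⊕ Fin n) K) :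
    d i * quantize w = quantize w * d i + quantize (pderiv (Sum.inl i) w) := by
  induction w using MvPolynomial.induction_on with
  | C c => simp [quantize_C, Algebra.commutes]
  | add p q hp hq => simp only [map_add, mul_add, add_mul, hp, hq]; abel
  | mul_X p j hp =>
    rw [mul_comm p, Derivation.leibniz, smul_eq_mul, smul_eq_mul, map_add, pderiv_X,
      Pi.single_apply]
    rcases j with j | j
    · rw [quantize_X_inl_mul, quantize_X_inl_mul, ← mul_assoc, d_mul_x, add_mul, mul_assoc, hp]
      by_cases h : i = j
      · simp [h, mul_add, mul_assoc, add_assoc]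
      · simp [h, Ne.symm h, mul_add, mul_assoc]
    · rw [quantize_X_inr_mul, quantize_X_inr_mul, ← mul_assoc, hp]
      simp [add_mul, mul_assoc, sub_eq_zero.1 (d_d i j)]

/-- Commutation with `x_i` differentiates the symbol with respect to `ξ_i`. -/
theorem quantize_mul_x (i : Fin n) (w : MvPolynomial (Fin n ⊕ Fin n) K) :
    quantize w * x i = x i * quantize w + quantize (pderiv (Sum.inr i) w) := by
  induction w using MvPolynomial.induction_on with
  | C c => simp [quantize_C, Algebra.commutes]
  | add p q hp hq => simp only [map_add, mul_add, add_mul, hp, hq]; abel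
  | mul_X p j hp =>
    rw [mul_comm p, Derivation.leibniz, smul_eq_mul, smul_eq_mul, map_add, pderiv_X,
      Pi.single_apply]
    rcases j with j | j
    · rw [quantize_X_inl_mul, quantize_X_inl_mul, mul_assoc, hp]
      simp [mul_add, ← mul_assoc, sub_eq_zero.1 (x_x j i)]
    · rw [quantize_X_inr_mul, quantize_X_inr_mul, mul_assoc, d_mul_x, mul_add, ← mul_assoc, hp]
      by_cases h : i = j
      · simp [h, add_mul, mul_assoc]; abel
      · simp [Ne.symm h, add_mul, mul_assoc]

/-! ### The filtration by order of the symbol -/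

/-- The elements of `A_n` with a symbol of total degree at most `s`. -/
def bernstein (K : Type*) [Field K] (n s : ℕ) : Submodule K (Weyl K n) :=
  (restrictTotalDegree (Fin n ⊕ Fin n) K s).map quantize

theorem quantize_mem_bernstein {w : MvPolynomial (Fin n ⊕ Fin n) K} {s : ℕ}
    (hw : w.totalDegree ≤ s) : quantize w ∈ bernstein K n s :=
  Submodule.mem_map_of_mem ((mem_restrictTotalDegree _ _ _).2 hw)

theorem bernstein_mono {s t : ℕ} (h : s ≤ t) : bernstein K n s ≤ bernstein K n t := by
  rintro _ ⟨w, hw, rfl⟩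
  exact quantize_mem_bernstein (((mem_restrictTotalDegree _ _ _).1 hw).trans h)

theorem one_mem_bernstein (s : ℕ) : (1 : Weyl K n) ∈ bernstein K n s := by
  rw [← quantize_one]; exact quantize_mem_bernstein (by simp)

theorem x_mul_mem_bernstein (i : Fin n) {s : ℕ} {b : Weyl K n} (hb : b ∈ bernstein K n s) :
    x i * b ∈ bernstein K n (s + 1) := by
  obtain ⟨w, hw, rfl⟩ := hb
  have hw : w.totalDegree ≤ s := (mem_restrictTotalDegree _ _ _).1 hw
  rw [← quantize_X_inl_mul]
  exact quantize_mem_bernstein ((totalDegree_X_mul_le _ _).trans (by omega))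

theorem d_mul_mem_bernstein (i : Fin n) {s : ℕ} {b : Weyl K n} (hb : b ∈ bernstein K n s) :
    d i * b ∈ bernstein K n (s + 1) := by
  obtain ⟨w, hw, rfl⟩ := hb
  have hw : w.totalDegree ≤ s := (mem_restrictTotalDegree _ _ _).1 hw
  rw [d_mul_quantize, ← quantize_X_inr_mul]
  exact add_mem (quantize_mem_bernstein ((totalDegree_X_mul_le _ _).trans (by omega)))
    (quantize_mem_bernstein ((totalDegree_pderiv_le _ _).trans (by omega)))

theorem quantize_monomial_mul_mem (a : Fin n ⊕ Fin n →₀ ℕ) :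
    ∀ (t : ℕ) (b : Weyl K n), b ∈ bernstein K n t →
      quantize (monomial a 1) * b ∈ bernstein K n (a.degree + t) := by
  induction a using exponent_induction with
  | zero => intro t b hb; simpa using hb
  | add_single a i ih =>
    intro t b hb
    have h : (monomial (a + Finsupp.single i 1) 1 : MvPolynomial (Fin n ⊕ Fin n) K)
        = X i * monomial a 1 := by
      rw [X, monomial_mul, one_mul, add_comm]
    rw [h, map_add, Finsupp.degree_single]
    rcases i with i | i
    · rw [quantize_X_inl_mul, mul_assoc, add_right_comm]
      exact x_mul_mem_bernstein i (ih t b hb)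
    · rw [quantize_X_inr_mul, mul_assoc, add_assoc, add_comm 1]
      exact ih _ _ (d_mul_mem_bernstein i hb)

theorem mul_mem_bernstein {s t : ℕ} {a b : Weyl K n} (ha : a ∈ bernstein K n s)
    (hb : b ∈ bernstein K n t) : a * b ∈ bernstein K n (s + t) := by
  obtain ⟨w, hw, rfl⟩ := ha
  have hw : w.totalDegree ≤ s := (mem_restrictTotalDegree _ _ _).1 hw
  rw [w.as_sum, map_sum, Finset.sum_mul]
  refine sum_mem fun c hc => ?_
  have h : monomial c (coeff c w) =
      coeff c w • (monomial c 1 : MvPolynomial (Fin n ⊕ Fin n) K) := by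
    rw [smul_monomial, smul_eq_mul, mul_one]
  rw [h, map_smul, smul_mul_assoc]
  refine Submodule.smul_mem _ _ (bernstein_mono ?_ (quantize_monomial_mul_mem c t b hb))
  exact Nat.add_le_add_right ((le_totalDegree hc).trans hw) _

end Weyl

end JacWeyl

end

noncomputable section

namespace JacWeyl

open MvPolynomial

theorem exists_eq_C_of_pderiv_eq_zero {K τ : Type*} [Field K] [CharZero K]
    (w : MvPolynomial τ K) (h : ∀ i, pderiv i w = 0) : ∃ c, w = C c := by
  classical
  refine ⟨coeff 0 w, ?_⟩
  ext a
  rw [coeff_C]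
  split_ifs with ha
  · rw [← ha]
  · by_contra hne
    obtain ⟨i, hi⟩ : ∃ i, a i ≠ 0 := by
      by_contra! hall
      exact ha (Finsupp.ext hall).symm
    have h1 := congrArg (coeff (a - Finsupp.single i 1)) (h i)
    rw [coeff_pderiv] at h1
    rw [tsub_add_cancel_of_le (Finsupp.single_le_iff.2 (Nat.one_le_iff_ne_zero.2 hi)),
      coeff_zero] at h1
    exact (mul_eq_zero.1 h1).elim hne (Nat.cast_add_one_ne_zero _)

namespace Weyl

variable {K : Type*} [Field K] {n : ℕ}
variable {M : Type*} [AddCommGroup M] [Module K M] [Module (Weyl K n) M]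
  [IsScalarTower K (Weyl K n) M]

/-! ### Bernstein's inequality -/

/-- The map sending a symbol `w` to `w(x, ∂) u`. -/
def symbolAct (u : M) : MvPolynomial (Fin n ⊕ Fin n) K →ₗ[K] M :=
  ((LinearMap.toSpanSingleton (Weyl K n) M u).restrictScalars K).comp quantize

theorem symbolAct_apply (u : M) (w : MvPolynomial (Fin n ⊕ Fin n) K) :
    symbolAct u w = quantize w • u := rfl

variable (K n) in
/-- The subspace of the elements `b • u` with `b` in the `s`-th step of the filtration of `A_n`. -/
def orbit (u : M) (s : ℕ) : Submodule K M :=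
  (restrictTotalDegree (Fin n ⊕ Fin n) K s).map (symbolAct u)

theorem mem_orbit {u : M} {s : ℕ} {m : M} :
    m ∈ orbit K n u s ↔ ∃ b ∈ bernstein K n s, b • u = m := by
  constructor
  · rintro ⟨w, hw, rfl⟩
    exact ⟨quantize w, Submodule.mem_map_of_mem hw, rfl⟩
  · rintro ⟨_, ⟨w, hw, rfl⟩, rfl⟩
    exact ⟨w, hw, rfl⟩

theorem orbit_eq_span (u : M) (s : ℕ) :
    orbit K n u s = Submodule.span K
      ((fun a => quantize (monomial a 1 : MvPolynomial (Fin n ⊕ Fin n) K) • u)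
        '' {a | a.degree ≤ s}) := by
  rw [orbit, restrictTotalDegree, restrictSupport_eq_span, Submodule.map_span, ← Set.image_comp]
  rfl

instance finiteDimensional_restrictTotalDegree {τ : Type*} [Finite τ] (s : ℕ) :
    FiniteDimensional K (restrictTotalDegree τ K s) := by
  have : Finite {a : τ →₀ ℕ | (a.sum fun _ e => e) ≤ s} := Finsupp.finite_of_degree_le (σ := τ) s
  exact Module.Finite.of_basis (basisRestrictSupport K _)

theorem finrank_restrictTotalDegree {τ : Type*} [Fintype τ] (s : ℕ) :
    Module.finrank K (restrictTotalDegree τ K s) = (s + Fintype.card τ).choose s := by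
  rw [← ncard_degree_le (ι := τ) s]
  exact Module.finrank_eq_nat_card_basis (basisRestrictSupport K _)

instance (u : M) (s : ℕ) : FiniteDimensional K (orbit K n u s) := by
  unfold orbit; infer_instance

/-- A nonzero element of the Weyl algebra cannot annihilate a whole step of the filtration of a
nonzero cyclic module, as long as its own degree does not exceed that step. -/
theorem exists_quantize_mul_smul_ne_zero [CharZero K] {u : M} (hu : u ≠ 0) (s : ℕ) :
    ∀ w : MvPolynomial (Fin n ⊕ Fin n) K, w ≠ 0 → w.totalDegree ≤ s →
      ∃ b ∈ bernstein K n s, quantize w • b • u ≠ 0 := by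
  have hconst (s : ℕ) (w : MvPolynomial (Fin n ⊕ Fin n) K) (hw : w ≠ 0)
      (h : ∃ c, w = C c) : ∃ b ∈ bernstein K n s, quantize w • b • u ≠ 0 := by
    obtain ⟨c, rfl⟩ := h
    refine ⟨1, one_mem_bernstein s, ?_⟩
    rw [quantize_C, one_smul, algebraMap_smul]
    exact smul_ne_zero (fun h => hw (by rw [h, map_zero])) hu
  induction s with
  | zero =>
    intro w hw hs
    exact hconst 0 w hw ⟨_, totalDegree_eq_zero_iff_eq_C.1 (Nat.le_zero.1 hs)⟩
  | succ s ih =>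
    intro w hw hs
    by_cases hp : ∀ k, pderiv k w = 0
    · exact hconst _ w hw (exists_eq_C_of_pderiv_eq_zero w hp)
    push Not at hp
    obtain ⟨k, hk⟩ := hp
    obtain ⟨b, hb, hne⟩ := ih _ hk ((totalDegree_pderiv_le k w).trans (by omega))
    by_contra! hall
    have h0 := hall b (bernstein_mono (Nat.le_succ s) hb)
    refine hne ?_
    -- The derivative of the symbol is the commutator with a generator.
    rcases k with i | i
    · have h1 := hall _ (d_mul_mem_bernstein i hb)
      have h2 := congrArg (fun a : Weyl K n => a • b • u) (d_mul_quantize i w)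
      simp only [add_smul, mul_smul] at h1 h2
      rw [h0, h1, smul_zero, zero_add] at h2
      exact h2.symm
    · have h1 := hall _ (x_mul_mem_bernstein i hb)
      have h2 := congrArg (fun a : Weyl K n => a • b • u) (quantize_mul_x i w)
      simp only [add_smul, mul_smul] at h1 h2
      rw [h0, h1, smul_zero, zero_add] at h2
      exact h2.symm

/-- The operators of order at most `s` embed into the linear maps from the `s`-th to the `2 s`-th
step of the filtration of a nonzero cyclic module; the left side is the number of symbols. -/
theorem choose_le_finrank_orbit_mul [CharZero K] {u : M} (hu : u ≠ 0) (s : ℕ) :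
    (s + 2 * n).choose s ≤
      Module.finrank K (orbit K n u s) * Module.finrank K (orbit K n u (2 * s)) := by
  let e := Module.finBasis K (orbit K n u s)
  have hmem (w : restrictTotalDegree (Fin n ⊕ Fin n) K s) (m : orbit K n u s) :
      symbolAct (m : M) w.1 ∈ orbit K n u (2 * s) := by
    obtain ⟨b, hb, hm⟩ := mem_orbit.1 m.2
    rw [symbolAct_apply, ← hm, smul_smul]
    refine mem_orbit.2 ⟨_, ?_, rfl⟩
    rw [two_mul]
    exact mul_mem_bernstein (Submodule.mem_map_of_mem w.2) hb
  let T : restrictTotalDegree (Fin n ⊕ Fin n) K s →ₗ[K]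
      (Fin (Module.finrank K (orbit K n u s)) → orbit K n u (2 * s)) :=
    LinearMap.pi fun i => LinearMap.codRestrict _
      ((symbolAct (e i : M)).comp (Submodule.subtype _)) fun w => hmem w (e i)
  have hT : Function.Injective T := by
    rw [← LinearMap.ker_eq_bot, LinearMap.ker_eq_bot']
    intro w hw
    by_contra hne
    obtain ⟨b, hb, h⟩ := exists_quantize_mul_smul_ne_zero hu s w.1 (fun h => hne (Subtype.ext h))
      ((mem_restrictTotalDegree _ _ _).1 w.2)
    refine h ?_
    let m : orbit K n u s := ⟨b • u, mem_orbit.2 ⟨b, hb, rfl⟩⟩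
    have hm := congrArg (Subtype.val) (e.sum_repr m)
    change _ = b • u at hm
    rw [← hm, AddSubmonoidClass.coe_finsetSum, Finset.smul_sum]
    refine Finset.sum_eq_zero fun i _ => ?_
    have hi : quantize w.1 • (e i : M) = 0 := congrArg Subtype.val (congrFun hw i)
    rw [Submodule.coe_smul, smul_algebra_smul_comm, hi, smul_zero]
  have h := LinearMap.finrank_le_finrank_of_injective hT
  rwa [finrank_restrictTotalDegree, Module.finrank_pi_fintype, Finset.sum_const, Finset.card_univ,
    Fintype.card_fin, smul_eq_mul, Fintype.card_sum, Fintype.card_fin, ← two_mul] at h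

/-- The sharp form of Bernstein's inequality: in the filtration generated by a nonzero element,
a module over the Weyl algebra grows at least as fast as the polynomial ring in `n` variables. -/
theorem choose_le_finrank_orbit [CharZero K] (hn : 1 ≤ n) {u : M} (hu : u ≠ 0) (s : ℕ) :
    (s + n).choose s ≤ Module.finrank K (orbit K n u s) := by
  classical
  obtain ⟨S, hS, hcard⟩ := exists_isLowerSet_finrank_eq (K := K)
    (fun a => quantize (monomial a 1 : MvPolynomial (Fin n ⊕ Fin n) K) • u)
    (Sum.elim (fun i => Algebra.lsmul K K M (x i : Weyl K n))
      (fun i => Algebra.lsmul K K M (d i : Weyl K n))) (by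
    intro k a
    have h : (monomial (a + Finsupp.single k 1) 1 : MvPolynomial (Fin n ⊕ Fin n) K)
        = X k * monomial a 1 := by
      rw [X, monomial_mul, one_mul, add_comm]
    rw [h]
    rcases k with i | i
    · simp [quantize_X_inl_mul, mul_smul]
    · change (d i : Weyl K n) • quantize (monomial a (1 : K)) • u - _ ∈ _
      rw [smul_smul (d i : Weyl K n), d_mul_quantize, quantize_X_inr_mul,
        ← sub_smul, add_sub_cancel_left, ← orbit_eq_span (K := K) u]
      refine mem_orbit.2 ⟨_, quantize_mem_bernstein (K := K) ?_, rfl⟩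
      exact (totalDegree_pderiv_le _ _).trans
        ((Nat.sub_le _ _).trans (totalDegree_monomial_le _ _)))
  replace hcard (s : ℕ) : Module.finrank K (orbit K n u s) = (S ∩ {a | a.degree ≤ s}).ncard := by
    rw [orbit_eq_span]
    exact hcard s
  by_cases hcone : ∃ T : Finset (Fin n ⊕ Fin n), T.card = n ∧
      ∀ a : Fin n ⊕ Fin n →₀ ℕ, a.support ⊆ T → a ∈ S
  · obtain ⟨T, hT, hTS⟩ := hcone
    have hT' := ncard_expsOn T s
    rw [hT] at hT'
    rw [hcard, ← hT']
    exact Set.ncard_le_ncard (fun a ha => ⟨hTS a ha.1, ha.2⟩)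
      ((Finsupp.finite_of_degree_le s).inter_of_right _)
  · exfalso
    push Not at hcone
    obtain ⟨r, rfl⟩ : ∃ r, n = r + 1 := ⟨n - 1, by omega⟩
    obtain ⟨c, hc⟩ := exists_ncard_inter_le S hS r hcone
    -- The product in the dimension estimate would grow with degree `2 * r`, less than `2 * n`.
    have hbound (s : ℕ) : (s + 1) ^ 2 ≤ (2 * (r + 1)).factorial * (c * c * 2 ^ r) := by
      have h1 := choose_le_finrank_orbit_mul (K := K) (n := r + 1) hu s
      have h2 := hc s
      have h3 := hc (2 * s)
      rw [← hcard] at h2 h3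
      have h4 : (2 * s + 1) ^ r ≤ 2 ^ r * (s + 1) ^ r := by
        rw [← mul_pow]; exact Nat.pow_le_pow_left (by omega) r
      have h5 := Nat.pow_succ_le_ascFactorial (s + 1) (2 * (r + 1))
      rw [Nat.ascFactorial_eq_factorial_mul_choose] at h5
      have h6 : (s + 2 * (r + 1)).choose (2 * (r + 1)) = (s + 2 * (r + 1)).choose s := by
        rw [Nat.choose_symm_add]
      rw [h6] at h5
      refine Nat.le_of_mul_le_mul_right (c := ((s + 1) ^ r * (s + 1) ^ r)) ?_ (by positivity)
      calc (s + 1) ^ 2 * ((s + 1) ^ r * (s + 1) ^ r) = (s + 1) ^ (2 * (r + 1)) := by ring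
        _ ≤ _ := h5
        _ ≤ (2 * (r + 1)).factorial * ((c * (s + 1) ^ r) * (c * (2 ^ r * (s + 1) ^ r))) :=
          Nat.mul_le_mul_left _ (h1.trans (Nat.mul_le_mul h2
            (h3.trans (Nat.mul_le_mul_left _ h4))))
        _ = _ := by ring
    have := hbound ((2 * (r + 1)).factorial * (c * c * 2 ^ r))
    nlinarith

end Weyl

end JacWeyl

end

noncomputable section

namespace JacWeyl

open MvPolynomial

namespace Weyl

variable {K : Type*} [Field K] {n : ℕ}
/-! ### Growth estimates -/

theorem factorial_mul_choose_le (t n : ℕ) : n.factorial * (t + n).choose t ≤ (t + n) ^ n := by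
  rw [Nat.choose_symm_add, ← Nat.ascFactorial_eq_factorial_mul_choose]
  exact Nat.ascFactorial_le_pow_add t n

theorem pow_le_factorial_mul_choose (t n : ℕ) :
    (t + 1) ^ n ≤ n.factorial * (t + n).choose t := by
  rw [Nat.choose_symm_add, ← Nat.ascFactorial_eq_factorial_mul_choose]
  exact Nat.pow_succ_le_ascFactorial (t + 1) n

theorem le_pow_of_forall_mul_choose_le {l m c n : ℕ}
    (h : ∀ s : ℕ, l * (s + n).choose s ≤ (m * s + c + n).choose (m * s + c)) : l ≤ m ^ n := by
  have h1 (s : ℕ) : l * (s + 1) ^ n ≤ (m * (s + 1) + (c + n)) ^ n :=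
    calc l * (s + 1) ^ n ≤ l * (n.factorial * (s + n).choose s) :=
          Nat.mul_le_mul_left _ (pow_le_factorial_mul_choose s n)
      _ = n.factorial * (l * (s + n).choose s) := by ring
      _ ≤ n.factorial * (m * s + c + n).choose (m * s + c) := Nat.mul_le_mul_left _ (h s)
      _ ≤ (m * s + c + n) ^ n := factorial_mul_choose_le _ _
      _ ≤ _ := Nat.pow_le_pow_left (by nlinarith) n
  have h2 (s : ℕ) : (l : ℝ) ≤ (m + ((c + n : ℕ) : ℝ) / ((s : ℝ) + 1)) ^ n := by
    have h3 : (l : ℝ) * ((s : ℝ) + 1) ^ n ≤ (m * ((s : ℝ) + 1) + ((c + n : ℕ) : ℝ)) ^ n := by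
      exact_mod_cast h1 s
    have hs : (0 : ℝ) < (s : ℝ) + 1 := by positivity
    have h4 : (m + ((c + n : ℕ) : ℝ) / ((s : ℝ) + 1)) * ((s : ℝ) + 1)
        = m * ((s : ℝ) + 1) + ((c + n : ℕ) : ℝ) := by
      field_simp
    rw [← h4, mul_pow] at h3
    exact le_of_mul_le_mul_right h3 (by positivity)
  have h5 : Filter.Tendsto (fun s : ℕ => (m + ((c + n : ℕ) : ℝ) / ((s : ℝ) + 1)) ^ n)
      Filter.atTop (nhds (((m : ℝ) + 0) ^ n)) := by
    refine (tendsto_const_nhds.add ?_).pow n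
    exact tendsto_const_div_atTop_nhds_zero_nat ((c + n : ℕ) : ℝ)
      |>.comp (Filter.tendsto_add_atTop_nat 1) |>.congr fun s => by simp
  have h6 := ge_of_tendsto' h5 h2
  rw [add_zero] at h6
  exact_mod_cast h6

theorem finrank_add_finrank_le {V W : Type*} [AddCommGroup V] [Module K V] [AddCommGroup W]
    [Module K W] (f : V →ₗ[K] W) {G' G : Submodule K V} {O : Submodule K W}
    [FiniteDimensional K G] (hle : G' ≤ G) (hker : G' ≤ LinearMap.ker f) (hO : O ≤ G.map f) :
    Module.finrank K G' + Module.finrank K O ≤ Module.finrank K G := by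
  have h := LinearMap.finrank_range_add_finrank_ker (f.domRestrict G)
  rw [LinearMap.range_domRestrict] at h
  have h1 : Module.finrank K O ≤ Module.finrank K (G.map f) := Submodule.finrank_mono hO
  have h2 : Module.finrank K G' ≤ Module.finrank K (LinearMap.ker (f.domRestrict G)) := by
    rw [← (Submodule.comapSubtypeEquivOfLe hle).finrank_eq]
    exact Submodule.finrank_mono fun v hv => hker hv
  omega

theorem length_le_of_forall_series {R N : Type*} [Ring R] [AddCommGroup N] [Module R N] {k : ℕ}
    (h : ∀ p : LTSeries (Submodule R N), p.length ≤ k) : Module.length R N ≤ k := by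
  rw [← WithBot.coe_le_coe, Module.coe_length]
  exact iSup_le fun p => by exact_mod_cast h p

/-! ### Modules with a filtration of polynomial growth of degree `n` -/

variable {M : Type*} [AddCommGroup M] [Module K M] [Module (Weyl K n) M]

variable (K n) in
/-- An exhaustive increasing filtration of a module over the Weyl algebra whose steps are no larger
than those of the degree filtration of the polynomial ring in `n` variables, such that the
generators of the Weyl algebra raise the index by at most `m`. -/
structure IsDegreeFiltration (m : ℕ) (F : ℕ → Submodule K M) : Prop where
  mono : Monotone F
  exists_mem : ∀ u, ∃ t, u ∈ F t
  x_smul_mem : ∀ i t, ∀ u ∈ F t, (x i : Weyl K n) • u ∈ F (t + m)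
  d_smul_mem : ∀ i t, ∀ u ∈ F t, (d i : Weyl K n) • u ∈ F (t + m)
  finite : ∀ t, FiniteDimensional K (F t)
  finrank_le : ∀ t, Module.finrank K (F t) ≤ (t + n).choose t

variable {m : ℕ} {F : ℕ → Submodule K M}

theorem IsDegreeFiltration.quantize_monomial_smul_mem (hF : IsDegreeFiltration K n m F)
    (a : Fin n ⊕ Fin n →₀ ℕ) : ∀ (t : ℕ) (u : M), u ∈ F t →
      quantize (monomial a (1 : K)) • u ∈ F (m * a.degree + t) := by
  induction a using exponent_induction with
  | zero => intro t u hu; simpa using hu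
  | add_single a i ih =>
    intro t u hu
    have h : (monomial (a + Finsupp.single i 1) 1 : MvPolynomial (Fin n ⊕ Fin n) K)
        = X i * monomial a 1 := by
      rw [X, monomial_mul, one_mul, add_comm]
    rw [h, map_add, Finsupp.degree_single, mul_add, mul_one]
    rcases i with i | i
    · rw [quantize_X_inl_mul, mul_smul, add_right_comm]
      exact hF.x_smul_mem _ _ _ (ih _ _ hu)
    · rw [quantize_X_inr_mul, mul_smul, add_assoc, add_comm m]
      exact ih _ _ (hF.d_smul_mem _ _ _ hu)

section Growth

variable [IsScalarTower K (Weyl K n) M]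

theorem IsDegreeFiltration.orbit_le (hF : IsDegreeFiltration K n m F) {u : M} {t : ℕ}
    (hu : u ∈ F t) (s : ℕ) : orbit K n u s ≤ F (m * s + t) := by
  rw [orbit_eq_span, Submodule.span_le]
  rintro _ ⟨a, ha, rfl⟩
  exact hF.mono (Nat.add_le_add_right (Nat.mul_le_mul_left _ ha) _)
    (hF.quantize_monomial_smul_mem a t u hu)

/-! ### Length -/

/-- Each step of a chain of submodules adds the growth of a nonzero cyclic module to the dimension of
a step of the filtration, so the leading terms in `s` bound the number of steps. -/
theorem IsDegreeFiltration.length_series_le [CharZero K] (hn : 1 ≤ n)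
    (hF : IsDegreeFiltration K n m F) (p : LTSeries (Submodule (Weyl K n) M)) :
    p.length ≤ m ^ n := by
  have hstep (i : Fin p.length) : ∃ u ∈ p i.succ, u ∉ p i.castSucc :=
    SetLike.exists_of_lt (p.step i)
  choose u hu hu' using hstep
  choose t ht using hF.exists_mem
  set c := Finset.univ.sup fun i => t (u i)
  have huc (i : Fin p.length) : u i ∈ F c :=
    hF.mono (Finset.le_sup (f := fun i => t (u i)) (Finset.mem_univ i)) (ht (u i))
  refine le_pow_of_forall_mul_choose_le (c := c) fun s => ?_
  have := hF.finite
  -- The subquotient of step `k` contains the orbit of the class of `u k`.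
  have key (k : ℕ) (hk : k < p.length + 1) : k * (s + n).choose s ≤
      Module.finrank K (F (m * s + c) ⊓ (p ⟨k, hk⟩).restrictScalars K : Submodule K M) := by
    induction k with
    | zero => simp
    | succ k ih =>
      let i : Fin p.length := ⟨k, by omega⟩
      specialize ih (by omega)
      change _ ≤ Module.finrank K
        (F (m * s + c) ⊓ (p i.castSucc).restrictScalars K : Submodule K M) at ih
      change _ ≤ Module.finrank K (F (m * s + c) ⊓ (p i.succ).restrictScalars K : Submodule K M)
      have hne : (p i.castSucc).mkQ (u i) ≠ 0 := by
        rw [Submodule.mkQ_apply, Ne, Submodule.Quotient.mk_eq_zero]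
        exact hu' i
      have h := finrank_add_finrank_le ((p i.castSucc).mkQ.restrictScalars K)
        (G' := F (m * s + c) ⊓ (p i.castSucc).restrictScalars K)
        (G := F (m * s + c) ⊓ (p i.succ).restrictScalars K)
        (O := orbit K n ((p i.castSucc).mkQ (u i)) s)
        (inf_le_inf_left _ (p.step i).le)
        (fun v hv => by simpa using hv.2)
        (fun v hv => by
          obtain ⟨b, hb, rfl⟩ := mem_orbit.1 hv
          exact ⟨b • u i, ⟨hF.orbit_le (huc i) s (mem_orbit.2 ⟨b, hb, rfl⟩),
            Submodule.smul_mem _ _ (hu i)⟩, by simp⟩)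
      have h2 := choose_le_finrank_orbit (K := K) hn hne s
      rw [add_mul, one_mul]
      omega
  refine (key p.length (Nat.lt_succ_self _)).trans ((Submodule.finrank_mono inf_le_left).trans ?_)
  exact hF.finrank_le _

theorem IsDegreeFiltration.length_le [CharZero K] (hn : 1 ≤ n)
    (hF : IsDegreeFiltration K n m F) : Module.length (Weyl K n) M ≤ (m ^ n : ℕ) :=
  length_le_of_forall_series (hF.length_series_le hn)

/-! ### Cyclicity -/

theorem IsDegreeFiltration.exists_quantize_smul_eq_zero (hn : 1 ≤ n)
    (hF : IsDegreeFiltration K n m F) (u : M) :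
    ∃ w : MvPolynomial (Fin n ⊕ Fin n) K, w ≠ 0 ∧ quantize w • u = 0 := by
  by_contra! hinj
  obtain ⟨t, ht⟩ := hF.exists_mem u
  have := hF.finite
  have hb (s : ℕ) : (s + 2 * n).choose s ≤ (m * s + t + n).choose (m * s + t) := by
    have hT : Function.Injective ((symbolAct u : MvPolynomial (Fin n ⊕ Fin n) K →ₗ[K] M)) := by
      rw [← LinearMap.ker_eq_bot, LinearMap.ker_eq_bot']
      intro w hw
      by_contra hne
      exact hinj w hne hw
    have h1 := (Submodule.equivMapOfInjective _ hT
      (restrictTotalDegree (Fin n ⊕ Fin n) K s)).finrank_eq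
    rw [finrank_restrictTotalDegree, Fintype.card_sum, Fintype.card_fin, ← two_mul] at h1
    rw [h1]
    exact (Submodule.finrank_mono (hF.orbit_le ht s)).trans (hF.finrank_le _)
  -- The left side grows with degree `2 * n` in `s` and the right side with degree `n`.
  have hE (s : ℕ) : (s + 1) ^ n ≤ (2 * n).factorial * (m + t + n) ^ n := by
    refine Nat.le_of_mul_le_mul_right (c := (s + 1) ^ n) ?_ (by positivity)
    calc (s + 1) ^ n * (s + 1) ^ n = (s + 1) ^ (2 * n) := by ring
      _ ≤ (2 * n).factorial * (s + 2 * n).choose s := pow_le_factorial_mul_choose s (2 * n)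
      _ ≤ (2 * n).factorial * (n.factorial * (m * s + t + n).choose (m * s + t)) :=
          Nat.mul_le_mul_left _ ((hb s).trans (Nat.le_mul_of_pos_left _ n.factorial_pos))
      _ ≤ (2 * n).factorial * (m * s + t + n) ^ n :=
          Nat.mul_le_mul_left _ (factorial_mul_choose_le _ _)
      _ ≤ (2 * n).factorial * ((m + t + n) * (s + 1)) ^ n :=
          Nat.mul_le_mul_left _ (Nat.pow_le_pow_left (by nlinarith) n)
      _ = _ := by rw [mul_pow]; ring
  have h1 := hE ((2 * n).factorial * (m + t + n) ^ n)
  have h2 := Nat.le_self_pow (Nat.one_le_iff_ne_zero.1 hn) ((2 * n).factorial * (m + t + n) ^ n + 1)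
  omega

/-- A module of finite length in which every element is annihilated by a nonzero element of the
Weyl algebra is cyclic. If `u` generates the module modulo `N` and `N'` is a maximal submodule of
`N`, then an operator killing `u` cannot map all of `N` into `N'`, so that it maps `u + s` outside
`N'` for some `s` in `N`; then `u + s` generates the module modulo `N'`. -/
theorem exists_span_singleton_eq_top [CharZero K] [IsNoetherian (Weyl K n) M]
    [IsArtinian (Weyl K n) M]
    (h : ∀ u : M, ∃ w : MvPolynomial (Fin n ⊕ Fin n) K, w ≠ 0 ∧ quantize w • u = 0) :
    ∃ v : M, Submodule.span (Weyl K n) {v} = ⊤ := by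
  let A : Set (Submodule (Weyl K n) M) := {N | ∃ u, Submodule.span (Weyl K n) {u} ⊔ N = ⊤}
  obtain ⟨N, ⟨u, hu⟩, hmin⟩ := WellFounded.has_min (wellFounded_lt (α := Submodule (Weyl K n) M)) A
    ⟨⊤, 0, by simp⟩
  by_cases hN : N = ⊥
  · exact ⟨u, by simpa [hN] using hu⟩
  exfalso
  obtain ⟨N', -, hN'⟩ := exists_le_covBy_of_lt (bot_lt_iff_ne_bot.2 hN)
  obtain ⟨s₀, hs₀, hs₀'⟩ := SetLike.exists_of_lt hN'.lt
  obtain ⟨w, hw, hwu⟩ := h u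
  have hne : N'.mkQ s₀ ≠ 0 := by
    rw [Submodule.mkQ_apply, Ne, Submodule.Quotient.mk_eq_zero]
    exact hs₀'
  obtain ⟨b, -, hb⟩ := exists_quantize_mul_smul_ne_zero (K := K) hne _ w hw le_rfl
  rw [← map_smul, ← map_smul, Submodule.mkQ_apply, Ne, Submodule.Quotient.mk_eq_zero] at hb
  have hs : b • s₀ ∈ N := Submodule.smul_mem _ _ hs₀
  refine hmin N' ⟨u + b • s₀, ?_⟩ hN'.lt
  set Q := Submodule.span (Weyl K n) {u + b • s₀} ⊔ N'
  have hmem : u + b • s₀ ∈ Q := le_sup_left (a := Submodule.span (Weyl K n) {u + b • s₀})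
    (Submodule.mem_span_singleton_self _)
  have hmem2 : quantize w • b • s₀ ∈ Q := by
    have := Submodule.smul_mem Q (quantize w) hmem
    rwa [smul_add, hwu, zero_add] at this
  have hNQ : N ≤ Q := by
    rcases hN'.eq_or_eq (le_inf hN'.le le_sup_right : N' ≤ N ⊓ Q) inf_le_left with h1 | h1
    · exact absurd (h1.le ⟨Submodule.smul_mem _ _ hs, hmem2⟩) hb
    · exact inf_eq_left.1 h1
  refine top_le_iff.1 (hu ▸ sup_le ?_ hNQ)
  rw [Submodule.span_singleton_le_iff_mem]
  simpa using sub_mem hmem (hNQ hs)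

end Growth

end Weyl

end JacWeyl

end

noncomputable section

namespace JacWeyl

open MvPolynomial

/-! ### Gelfand–Kirillov dimension -/

theorem limsup_log_div_log_le {f : ℕ → ℕ} {E n : ℕ} (h : ∀ s, 1 ≤ s → f s ≤ (E * s) ^ n) :
    Filter.limsup (fun s : ℕ => ((Real.log (f s) / Real.log s : ℝ) : EReal)) Filter.atTop
      ≤ (n : EReal) := by
  have hlog : Filter.Tendsto (fun s : ℕ => Real.log s) Filter.atTop Filter.atTop :=
    Real.tendsto_log_atTop.comp tendsto_natCast_atTop_atTop
  have h1 : Filter.Tendsto (fun s : ℕ => (n : ℝ) * Real.log (E + 1) / Real.log s + n)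
      Filter.atTop (nhds (0 + n)) :=
    (hlog.const_div_atTop _).add tendsto_const_nhds
  rw [zero_add] at h1
  have h2 := (continuous_coe_real_ereal.tendsto _).comp h1
  have h3 : (n : EReal) = ((n : ℝ) : EReal) := rfl
  rw [h3, ← h2.limsup_eq]
  refine Filter.limsup_le_limsup ?_
  filter_upwards [Filter.eventually_ge_atTop 2] with s hs
  rw [Function.comp_apply, EReal.coe_le_coe_iff]
  have hs' : (2 : ℝ) ≤ s := by exact_mod_cast hs
  have hpos : 0 < Real.log s := Real.log_pos (by linarith)
  have hE : (0 : ℝ) ≤ Real.log (E + 1) :=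
    Real.log_nonneg (by linarith [(E.cast_nonneg : (0 : ℝ) ≤ E)])
  rw [div_add' _ _ _ hpos.ne', div_le_div_iff_of_pos_right hpos, ← mul_add,
    ← Real.log_mul (by positivity) (by positivity)]
  -- Where `f` vanishes, its logarithm is `0` by convention.
  rcases Nat.eq_zero_or_pos (f s) with h0 | h0
  · rw [h0, Nat.cast_zero, Real.log_zero, Real.log_mul (by positivity) (by positivity)]
    positivity
  · rw [← Real.log_pow]
    refine Real.log_le_log (by exact_mod_cast h0) ?_
    calc (f s : ℝ) ≤ ((E : ℝ) * s) ^ n := by exact_mod_cast h s (by omega)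
      _ ≤ _ := by gcongr; linarith

theorem le_limsup_log_div_log {f : ℕ → ℕ} {E n : ℕ} (h : ∀ s, s ^ n ≤ E * f s) :
    (n : EReal) ≤
      Filter.limsup (fun s : ℕ => ((Real.log (f s) / Real.log s : ℝ) : EReal)) Filter.atTop := by
  have hlog : Filter.Tendsto (fun s : ℕ => Real.log s) Filter.atTop Filter.atTop :=
    Real.tendsto_log_atTop.comp tendsto_natCast_atTop_atTop
  have h1 : Filter.Tendsto (fun s : ℕ => (n : ℝ) - Real.log E / Real.log s)
      Filter.atTop (nhds (n - 0)) :=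
    tendsto_const_nhds.sub (hlog.const_div_atTop _)
  rw [sub_zero] at h1
  have h2 := (continuous_coe_real_ereal.tendsto _).comp h1
  have h3 : (n : EReal) = ((n : ℝ) : EReal) := rfl
  rw [h3, ← h2.limsup_eq]
  refine Filter.limsup_le_limsup ?_
  filter_upwards [Filter.eventually_ge_atTop 2] with s hs
  rw [Function.comp_apply, EReal.coe_le_coe_iff]
  have hs' : (2 : ℝ) ≤ s := by exact_mod_cast hs
  have hpos : 0 < Real.log s := Real.log_pos (by linarith)
  have hle := h s
  have hp : 0 < E * f s := lt_of_lt_of_le (by positivity) hle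
  have hE : (E : ℝ) ≠ 0 := by exact_mod_cast (Nat.pos_of_mul_pos_right hp).ne'
  have hf : (f s : ℝ) ≠ 0 := by exact_mod_cast (Nat.pos_of_mul_pos_left hp).ne'
  rw [sub_div' hpos.ne', div_le_div_iff_of_pos_right hpos, sub_le_iff_le_add', ← Real.log_mul hE hf,
    ← Real.log_pow]
  exact Real.log_le_log (by positivity) (by exact_mod_cast hle)

namespace Weyl

variable {K : Type*} [Field K] {n : ℕ}

theorem generators_induction {P : Weyl K n → Prop} (algebraMap : ∀ c, P (algebraMap K _ c))
    (x : ∀ i, P (x i)) (d : ∀ i, P (d i)) (add : ∀ a b, P a → P b → P (a + b))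
    (mul : ∀ a b, P a → P b → P (a * b)) (a : Weyl K n) : P a := by
  obtain ⟨f, rfl⟩ := RingQuot.mkAlgHom_surjective K (WeylRel K n) a
  induction f using FreeAlgebra.induction with
  | grade0 c => rw [AlgHom.commutes]; exact algebraMap c
  | grade1 i => exact i.rec x d
  | mul a b ha hb => rw [map_mul]; exact mul _ _ ha hb
  | add a b ha hb => rw [map_add]; exact add _ _ ha hb

instance (s : ℕ) : FiniteDimensional K (bernstein K n s) := by
  unfold bernstein; infer_instance

theorem bernstein_le_pow (s : ℕ) : bernstein K n s ≤ bernstein K n 1 ^ s := by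
  have hx (i : Fin n) : x i ∈ bernstein K n 1 := by
    simpa using x_mul_mem_bernstein i (one_mem_bernstein (K := K) 0)
  have hd (i : Fin n) : d i ∈ bernstein K n 1 := by
    simpa using d_mul_mem_bernstein i (one_mem_bernstein (K := K) 0)
  have h1 : (1 : Submodule K (Weyl K n)) ≤ bernstein K n 1 :=
    Submodule.one_le.2 (one_mem_bernstein 1)
  have hmon (a : Fin n ⊕ Fin n →₀ ℕ) :
      quantize (monomial a (1 : K)) ∈ bernstein K n 1 ^ a.degree := by
    induction a using exponent_induction with
    | zero => simpa using Submodule.one_le.1 (le_refl (1 : Submodule K (Weyl K n)))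
    | add_single a i ih =>
      have h : (monomial (a + Finsupp.single i 1) 1 : MvPolynomial (Fin n ⊕ Fin n) K)
          = X i * monomial a 1 := by
        rw [X, monomial_mul, one_mul, add_comm]
      rw [h, map_add, Finsupp.degree_single]
      rcases i with i | i
      · rw [quantize_X_inl_mul, pow_succ']
        exact Submodule.mul_mem_mul (hx i) ih
      · rw [quantize_X_inr_mul, pow_succ]
        exact Submodule.mul_mem_mul ih (hd i)
  rw [bernstein, restrictTotalDegree, restrictSupport_eq_span, Submodule.map_span,
    Submodule.span_le]
  rintro _ ⟨_, ⟨a, ha, rfl⟩, rfl⟩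
  exact pow_le_pow_right' h1 ha (hmon a)

variable {M : Type*} [AddCommGroup M] [Module K M] [Module (Weyl K n) M]
  [IsScalarTower K (Weyl K n) M] {m : ℕ} {F : ℕ → Submodule K M}

theorem IsDegreeFiltration.exists_smul_mem (hF : IsDegreeFiltration K n m F) (a : Weyl K n) :
    ∃ r, ∀ t, ∀ u ∈ F t, a • u ∈ F (t + r) := by
  induction a using generators_induction with
  | algebraMap c => exact ⟨0, fun t u hu => by simpa using Submodule.smul_mem _ c hu⟩
  | x i => exact ⟨m, hF.x_smul_mem i⟩
  | d i => exact ⟨m, hF.d_smul_mem i⟩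
  | add a b ha hb =>
    obtain ⟨r, hr⟩ := ha
    obtain ⟨r', hr'⟩ := hb
    refine ⟨r + r', fun t u hu => ?_⟩
    rw [add_smul]
    exact add_mem (hF.mono (by omega) (hr t u hu)) (hF.mono (by omega) (hr' t u hu))
  | mul a b ha hb =>
    obtain ⟨r, hr⟩ := ha
    obtain ⟨r', hr'⟩ := hb
    refine ⟨r' + r, fun t u hu => ?_⟩
    rw [mul_smul, ← add_assoc]
    exact hr _ _ (hr' t u hu)

theorem IsDegreeFiltration.exists_pow_smul_le (hF : IsDegreeFiltration K n m F)
    (V : Submodule K (Weyl K n)) [FiniteDimensional K V] (G : Submodule K M)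
    [FiniteDimensional K G] : ∃ r c, ∀ s, V ^ s • G ≤ F (r * s + c) := by
  obtain ⟨A, rfl⟩ := (Module.Finite.iff_fg.1 ‹FiniteDimensional K V› : V.FG)
  obtain ⟨B, rfl⟩ := (Module.Finite.iff_fg.1 ‹FiniteDimensional K G› : G.FG)
  choose r hr using hF.exists_smul_mem
  choose c hc using hF.exists_mem
  refine ⟨A.sup r, B.sup c, fun s => ?_⟩
  induction s with
  | zero =>
    rw [pow_zero, Submodule.one_smul, Submodule.span_le]
    exact fun u hu => hF.mono (by simpa using Finset.le_sup hu) (hc u)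
  | succ s ih =>
    rw [pow_succ', ← smul_eq_mul, Submodule.smul_assoc, Submodule.smul_le]
    intro a ha u hu
    have hu := ih hu
    have hsub : Submodule.span K (A : Set (Weyl K n)) ≤
        (F (A.sup r * (s + 1) + B.sup c)).comap
          ((LinearMap.toSpanSingleton (Weyl K n) M u).restrictScalars K) := by
      rw [Submodule.span_le]
      intro b hb
      refine hF.mono ?_ (hr b _ u hu)
      have := Finset.le_sup (f := r) hb
      rw [mul_add, mul_one]
      omega
    exact hsub ha

/-- A nonzero module with a filtration of polynomial growth of degree `n` has Gelfand–Kirillov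
dimension exactly `n`; the lower bound is Bernstein's inequality. -/
theorem IsDegreeFiltration.gkDim_eq [CharZero K] [Nontrivial M] (hn : 1 ≤ n)
    (hF : IsDegreeFiltration K n m F) : gkDim K (Weyl K n) M = n := by
  have := hF.finite
  refine le_antisymm ?_ ?_
  · refine iSup_le fun V => iSup_le fun _ => iSup_le fun hV => iSup_le fun G => iSup_le fun hG => ?_
    obtain ⟨r, c, h⟩ := hF.exists_pow_smul_le V G
    refine limsup_log_div_log_le (E := r + c + n) fun s hs => ?_
    calc Module.finrank K (V ^ s • G : Submodule K M) ≤ Module.finrank K (F (r * s + c)) :=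
          Submodule.finrank_mono (h s)
      _ ≤ (r * s + c + n).choose (r * s + c) := hF.finrank_le _
      _ ≤ n.factorial * (r * s + c + n).choose (r * s + c) :=
          Nat.le_mul_of_pos_left _ n.factorial_pos
      _ ≤ (r * s + c + n) ^ n := factorial_mul_choose_le _ _
      _ ≤ _ := Nat.pow_le_pow_left (by nlinarith) n
  · obtain ⟨u, hu⟩ := exists_ne (0 : M)
    refine le_trans ?_ (le_iSup₂_of_le (bernstein K n 1) (one_mem_bernstein 1) <|
      le_iSup₂_of_le inferInstance (Submodule.span K {u}) <| le_iSup_of_le inferInstance le_rfl)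
    refine le_limsup_log_div_log (E := n.factorial) fun s => ?_
    obtain ⟨r, c, h⟩ := hF.exists_pow_smul_le (bernstein K n 1) (Submodule.span K {u})
    have : FiniteDimensional K (bernstein K n 1 ^ s • Submodule.span K {u} : Submodule K M) :=
      Submodule.finiteDimensional_of_le (h s)
    have hle : orbit K n u s ≤ bernstein K n 1 ^ s • Submodule.span K {u} := by
      intro v hv
      obtain ⟨b, hb, rfl⟩ := mem_orbit.1 hv
      exact Submodule.smul_mem_smul (bernstein_le_pow s hb) (Submodule.mem_span_singleton_self u)
    calc s ^ n ≤ (s + 1) ^ n := Nat.pow_le_pow_left (Nat.le_succ s) n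
      _ ≤ n.factorial * (s + n).choose s := pow_le_factorial_mul_choose s n
      _ ≤ _ := Nat.mul_le_mul_left _
          ((choose_le_finrank_orbit hn hu s).trans (Submodule.finrank_mono hle))

end Weyl

end JacWeyl

end

noncomputable section

namespace JacWeyl

open MvPolynomial

variable {K : Type*} [Field K] {n : ℕ}

/-! ### Degrees of the derivations attached to a Jacobian map -/

theorem totalDegree_det_le {τ ι : Type*} [Fintype ι] [DecidableEq ι]
    (A : Matrix ι ι (MvPolynomial τ K)) (e : ι → ℕ) (h : ∀ i j, (A i j).totalDegree ≤ e i) :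
    A.det.totalDegree ≤ ∑ i, e i := by
  rw [Matrix.det_apply]
  refine (totalDegree_finsetSum _ _).trans (Finset.sup_le fun π _ => ?_)
  refine le_trans ?_ (Equiv.sum_comp π e).le
  have h1 : (∏ i, A (π i) i).totalDegree ≤ ∑ i, e (π i) :=
    (totalDegree_finsetProd _ _).trans (Finset.sum_le_sum fun i _ => h (π i) i)
  rcases Int.units_eq_one_or (Equiv.Perm.sign π) with hs | hs
  · rwa [hs, one_smul]
  · rwa [hs, Units.neg_smul, one_smul, totalDegree_neg]

variable {σ : MvPolynomial (Fin n) K →ₐ[K] MvPolynomial (Fin n) K}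

theorem totalDegree_apply_X_le (i : Fin n) : (σ (X i)).totalDegree ≤ endDegree σ :=
  Finset.le_sup (f := fun i => (σ (X i)).totalDegree) (Finset.mem_univ i)

/-- The determinant defining `∂_i' p` has `n - 1` rows of degree at most `d - 1` and one row of degree
at most `deg p - 1`. -/
theorem IsJacobianMap.totalDegree_derPrime_le (hσ : IsJacobianMap σ) (i : Fin n)
    (p : MvPolynomial (Fin n) K) :
    (derPrime σ i p).totalDegree ≤ p.totalDegree + ((n - 1) * (endDegree σ - 1) - 1) := by
  rcases Nat.eq_zero_or_pos p.totalDegree with h0 | h0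
  · rw [totalDegree_eq_zero_iff_eq_C.1 h0, derivation_C]
    simp
  obtain ⟨c, hc, hJ⟩ := hσ
  have hinv : Ring.inverse (jacobian σ) = C c⁻¹ := by
    have hu : IsUnit (C c : MvPolynomial (Fin n) K) := (isUnit_iff_ne_zero.2 hc).map C
    rw [hJ]
    refine hu.mul_left_cancel ?_
    rw [Ring.mul_inverse_cancel _ hu, ← C_mul, mul_inv_cancel₀ hc, C_1]
  rw [derPrime_apply, hinv]
  refine (totalDegree_mul _ _).trans ?_
  rw [totalDegree_C, zero_add]
  refine (totalDegree_det_le _ (fun k => if k = i then p.totalDegree - 1 else endDegree σ - 1)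
    fun k j => ?_).trans ?_
  · rw [jacobianMatrix_update]
    by_cases h : k = i
    · subst h
      simpa using totalDegree_pderiv_le j p
    · rw [Matrix.updateRow_ne h, if_neg h]
      exact (totalDegree_pderiv_le _ _).trans (Nat.sub_le_sub_right (totalDegree_apply_X_le k) 1)
  · have : ∑ k, (if k = i then p.totalDegree - 1 else endDegree σ - 1)
        = p.totalDegree - 1 + (n - 1) * (endDegree σ - 1) := by
      rw [← Finset.add_sum_erase _ _ (Finset.mem_univ i), if_pos rfl,
        Finset.sum_congr rfl fun k hk => if_neg (Finset.ne_of_mem_erase hk), Finset.sum_const,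
        Finset.card_erase_of_mem (Finset.mem_univ i), Finset.card_univ, Fintype.card_fin,
        smul_eq_mul]
    omega

/-- The degree filtration of `P_n`, as a filtration of the twisted module. -/
def twistedFiltration (hσ : IsJacobianMap σ) (t : ℕ) :
    Submodule K (Twisted hσ.extend (MvPolynomial (Fin n) K)) :=
  (restrictTotalDegree (Fin n) K t).map
    (Twisted.of hσ.extend (MvPolynomial (Fin n) K)).toLinearMap

theorem of_mem_twistedFiltration (hσ : IsJacobianMap σ) {t : ℕ} {p : MvPolynomial (Fin n) K}
    (h : p.totalDegree ≤ t) : Twisted.of hσ.extend _ p ∈ twistedFiltration hσ t :=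
  Submodule.mem_map_of_mem ((mem_restrictTotalDegree _ _ _).2 h)

theorem isDegreeFiltration_twistedFiltration (hσ : IsJacobianMap σ) :
    Weyl.IsDegreeFiltration K n (max (endDegree σ) ((n - 1) * (endDegree σ - 1) - 1))
      (twistedFiltration hσ) where
  mono := by
    rintro s t hst _ ⟨p, hp, rfl⟩
    exact of_mem_twistedFiltration hσ (((mem_restrictTotalDegree _ _ _).1 hp).trans hst)
  exists_mem u := ⟨_, of_mem_twistedFiltration hσ (p := u) le_rfl⟩
  x_smul_mem := by
    rintro i t _ ⟨p, hp, rfl⟩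
    have hp := (mem_restrictTotalDegree _ _ _).1 hp
    rw [LinearEquiv.coe_coe, hσ.x_smul_twisted]
    refine of_mem_twistedFiltration hσ ((totalDegree_mul _ _).trans ?_)
    have := totalDegree_apply_X_le (σ := σ) i
    omega
  d_smul_mem := by
    rintro i t _ ⟨p, hp, rfl⟩
    have hp := (mem_restrictTotalDegree _ _ _).1 hp
    rw [LinearEquiv.coe_coe, hσ.d_smul_twisted]
    refine of_mem_twistedFiltration hσ ((hσ.totalDegree_derPrime_le _ _).trans ?_)
    omega
  finite t := by
    unfold twistedFiltration; infer_instance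
  finrank_le t := by
    rw [twistedFiltration, LinearEquiv.finrank_map_eq, Weyl.finrank_restrictTotalDegree,
      Fintype.card_fin]

instance (hσ : IsJacobianMap σ) : Nontrivial (Twisted hσ.extend (MvPolynomial (Fin n) K)) :=
  inferInstanceAs (Nontrivial (MvPolynomial (Fin n) K))

/-! ### Surjective Jacobian maps -/

theorem IsJacobianMap.ofPoly_smul_twisted (hσ : IsJacobianMap σ) (g p : MvPolynomial (Fin n) K) :
    (Weyl.ofPoly g : Weyl K n) • Twisted.of hσ.extend _ p = Twisted.of hσ.extend _ (σ g * p) := by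
  have h : hσ.extend.comp Weyl.ofPoly = Weyl.ofPoly.comp σ := by
    refine MvPolynomial.algHom_ext fun i => ?_
    rw [AlgHom.comp_apply, AlgHom.comp_apply, Weyl.ofPoly_X, hσ.extend_x]
  have h2 := DFunLike.congr_fun h g
  rw [AlgHom.comp_apply, AlgHom.comp_apply] at h2
  rw [Twisted.smul_of, h2, Weyl.ofPoly_smul]

theorem IsJacobianMap.pderiv_eq_sum (hσ : IsJacobianMap σ) (j : Fin n)
    (p : MvPolynomial (Fin n) K) :
    pderiv j p = ∑ i, pderiv j (σ (X i)) * derPrime σ i p := by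
  have hsum (q : MvPolynomial (Fin n) K) : (∑ i, pderiv j (σ (X i)) • derPrime σ i) q =
      ∑ i, pderiv j (σ (X i)) * derPrime σ i q := by
    rw [← Derivation.coeFnAddMonoidHom_apply, map_sum, Finset.sum_apply]
    rfl
  have h : pderiv j - ∑ i, pderiv j (σ (X i)) • derPrime σ i = 0 := by
    refine hσ.der_eq_zero _ fun k => ?_
    simp [hsum, hσ.derPrime_X]
  have h2 := DFunLike.congr_fun h p
  simpa [hsum, sub_eq_zero] using h2

/-- If `σ` is surjective, then submodules of the twisted module are ideals of `P_n` stable under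
all partial derivatives, and repeated differentiation of a nonzero polynomial leads to a nonzero
constant. -/
theorem IsJacobianMap.isSimpleModule_twisted [CharZero K] (hσ : IsJacobianMap σ)
    (hsurj : Function.Surjective σ) :
    IsSimpleModule (Weyl K n) (Twisted hσ.extend (MvPolynomial (Fin n) K)) := by
  have key (N : Submodule (Weyl K n) (Twisted hσ.extend (MvPolynomial (Fin n) K))) (k : ℕ) :
      ∀ p : MvPolynomial (Fin n) K, p.totalDegree ≤ k → p ≠ 0 →
        Twisted.of hσ.extend _ p ∈ N → N = ⊤ := by
    have hmul (g p : MvPolynomial (Fin n) K) (hp : Twisted.of hσ.extend _ p ∈ N) :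
        Twisted.of hσ.extend _ (g * p) ∈ N := by
      obtain ⟨f, rfl⟩ := hsurj g
      rw [← hσ.ofPoly_smul_twisted]
      exact N.smul_mem _ hp
    have hC (p : MvPolynomial (Fin n) K) (hp : ∃ c, p = C c) (h0 : p ≠ 0)
        (hN : Twisted.of hσ.extend _ p ∈ N) : N = ⊤ := by
      obtain ⟨c, rfl⟩ := hp
      have hc : c ≠ 0 := fun h => h0 (by rw [h, map_zero])
      refine eq_top_iff.2 fun v _ => ?_
      have := hmul ((Twisted.of hσ.extend _).symm v * C c⁻¹) _ hN
      rwa [mul_assoc, ← C_mul, inv_mul_cancel₀ hc, C_1, mul_one, LinearEquiv.apply_symm_apply]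
        at this
    induction k with
    | zero =>
      intro p hp h0 hN
      exact hC p ⟨_, totalDegree_eq_zero_iff_eq_C.1 (Nat.le_zero.1 hp)⟩ h0 hN
    | succ k ih =>
      intro p hp h0 hN
      by_cases hd : ∀ j, pderiv j p = 0
      · exact hC p (exists_eq_C_of_pderiv_eq_zero p hd) h0 hN
      push Not at hd
      obtain ⟨j, hj⟩ := hd
      refine ih _ ((totalDegree_pderiv_le j p).trans (by omega)) hj ?_
      rw [hσ.pderiv_eq_sum, map_sum]
      refine sum_mem fun i _ => hmul _ _ ?_
      rw [← hσ.d_smul_twisted]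
      exact N.smul_mem _ hN
  refine { eq_bot_or_eq_top := fun N => ?_ }
  by_cases hN : N = ⊥
  · exact Or.inl hN
  · obtain ⟨v, hv, h0⟩ := N.exists_mem_ne_zero_of_ne_bot hN
    exact Or.inr (key N _ ((Twisted.of hσ.extend _).symm v) le_rfl h0 hv)

end JacWeyl

end

noncomputable section

namespace JacWeyl

open MvPolynomial TensorProduct

variable {K : Type*} [Field K] {n : ℕ}

/-! ### Jacobian maps are injective and étale -/

section Etale

variable {σ : MvPolynomial (Fin n) K →ₐ[K] MvPolynomial (Fin n) K}

theorem IsJacobianMap.derPrime_apply_map (hσ : IsJacobianMap σ) (i : Fin n)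
    (p : MvPolynomial (Fin n) K) : derPrime σ i (σ p) = σ (pderiv i p) := by
  induction p using MvPolynomial.induction_on with
  | C c => rw [← algebraMap_eq, AlgHom.commutes, algebraMap_eq, derivation_C, pderiv_C, map_zero]
  | add p q hp hq => simp only [map_add, hp, hq]
  | mul_X p j hp =>
    rw [map_mul, Derivation.leibniz, Derivation.leibniz, hp, hσ.derPrime_X, pderiv_X,
      Pi.single_apply]
    by_cases h : i = j
    · simp [h]
    · simp [h, Ne.symm h]

/-- The kernel is stable under all partial derivatives, so it would contain a nonzero constant. -/
theorem IsJacobianMap.injective [CharZero K] (hσ : IsJacobianMap σ) : Function.Injective σ := by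
  rw [injective_iff_map_eq_zero]
  suffices h : ∀ (k : ℕ) (p : MvPolynomial (Fin n) K), p.totalDegree ≤ k → σ p = 0 → p = 0 from
    fun p => h _ p le_rfl
  have hC (p : MvPolynomial (Fin n) K) (hp : ∃ c, p = C c) (h : σ p = 0) : p = 0 := by
    obtain ⟨c, rfl⟩ := hp
    rwa [← algebraMap_eq, AlgHom.commutes] at h
  intro k
  induction k with
  | zero => exact fun p hp => hC p ⟨_, totalDegree_eq_zero_iff_eq_C.1 (Nat.le_zero.1 hp)⟩
  | succ k ih =>
    intro p hp h
    refine hC p (exists_eq_C_of_pderiv_eq_zero p fun i => ?_) h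
    refine ih _ ((totalDegree_pderiv_le i p).trans (by omega)) ?_
    rw [← hσ.derPrime_apply_map, h, map_zero]

variable (σ) in
/-- The ring `P_n`, regarded as an algebra over `P_n` by means of `σ`; the type synonym keeps this
structure apart from that of `P_n` as an algebra over itself. -/
def Target (_σ : MvPolynomial (Fin n) K →ₐ[K] MvPolynomial (Fin n) K) : Type _ :=
  MvPolynomial (Fin n) K

instance : CommRing (Target σ) := inferInstanceAs (CommRing (MvPolynomial (Fin n) K))

instance : IsDomain (Target σ) := inferInstanceAs (IsDomain (MvPolynomial (Fin n) K))

instance : Algebra K (Target σ) := inferInstanceAs (Algebra K (MvPolynomial (Fin n) K))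

instance : Algebra (MvPolynomial (Fin n) K) (Target σ) := σ.toRingHom.toAlgebra

instance : IsScalarTower K (MvPolynomial (Fin n) K) (Target σ) :=
  IsScalarTower.of_algebraMap_eq fun c => (σ.commutes c).symm

variable (σ) in
/-- The identity map from `P_n` to its copy that is an algebra over `P_n` by means of `σ`. -/
def Target.of : MvPolynomial (Fin n) K ≃ₐ[K] Target σ := AlgEquiv.refl

theorem Target.algebraMap_apply (p : MvPolynomial (Fin n) K) :
    algebraMap (MvPolynomial (Fin n) K) (Target σ) p = Target.of σ (σ p) := rfl

theorem Target.aeval_map_C (p : MvPolynomial (Fin n) K) :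
    aeval (R := MvPolynomial (Fin n) K) (fun i => Target.of σ (X i)) (MvPolynomial.map C p)
      = Target.of σ p := by
  induction p using MvPolynomial.induction_on with
  | C c => rw [map_C, aeval_C, Target.algebraMap_apply, ← algebraMap_eq, AlgHom.commutes]
  | add p q hp hq => simp only [map_add, hp, hq]
  | mul_X p j hp => simp only [map_mul, hp, map_X, aeval_X]

/-- The presentation of `P_n` over itself, by means of `σ`, with generators `x_j` and relations
`σ(x_j)(x) = t_j`, where `t_j` are the variables of the base. -/
def Target.presentation : Algebra.PreSubmersivePresentation (MvPolynomial (Fin n) K) (Target σ)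
    (Fin n) (Fin n) where
  val i := Target.of σ (X i)
  σ' p := MvPolynomial.map C ((Target.of σ).symm p)
  aeval_val_σ' p := by rw [Target.aeval_map_C, AlgEquiv.apply_symm_apply]
  relation j := MvPolynomial.map C (σ (X j)) - C (X j)
  span_range_relation_eq_ker := by
    set I := Ideal.span (Set.range fun j : Fin n =>
      MvPolynomial.map C (σ (X j)) - (C (X j) : MvPolynomial (Fin n) (MvPolynomial (Fin n) K)))
    refine le_antisymm ?_ fun g hg => ?_
    · rw [Ideal.span_le]
      rintro _ ⟨j, rfl⟩
      change aeval (fun i => Target.of σ (X i)) _ = 0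
      rw [map_sub, Target.aeval_map_C, aeval_C, Target.algebraMap_apply, sub_self]
    · have hg : aeval (fun i => Target.of σ (X i)) g = 0 := hg
      -- Modulo the relations, every `g` equals its value, rewritten in the variables `x_i`.
      have h : (Ideal.Quotient.mk I) = (((Ideal.Quotient.mk I).comp (MvPolynomial.map C)).comp
          (Target.of σ).symm.toRingHom).comp (aeval fun i => Target.of σ (X i)).toRingHom := by
        refine MvPolynomial.ringHom_ext (fun r => ?_) fun i => ?_
        · induction r using MvPolynomial.induction_on with
          | C c =>
            have hc : σ (C c) = C c := by rw [← algebraMap_eq, AlgHom.commutes]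
            simp [Target.algebraMap_apply, hc]
          | add p q hp hq => simp only [map_add, hp, hq]
          | mul_X p j hp =>
            simp only [map_mul, hp]
            congr 1
            have h : Ideal.Quotient.mk I (MvPolynomial.map C (σ (X j))) =
                Ideal.Quotient.mk I (C (X j)) :=
              Ideal.Quotient.eq.2 (Ideal.subset_span ⟨j, rfl⟩)
            simp [Target.algebraMap_apply, h]
        · simp
      have h2 := DFunLike.congr_fun h g
      rw [RingHom.comp_apply] at h2
      change _ = _ at h2
      rw [← Ideal.Quotient.eq_zero_iff_mem, h2]
      simp [hg]
  map := id
  map_inj := Function.injective_id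

theorem IsJacobianMap.flat_target (hσ : IsJacobianMap σ) :
    Module.Flat (MvPolynomial (Fin n) K) (Target σ) := by
  have hu : IsUnit (Target.presentation (σ := σ)).jacobian := by
    classical
    rw [Algebra.PreSubmersivePresentation.jacobian_eq_jacobiMatrix_det, RingHom.map_det]
    have hJ := hσ.isUnit.map (Target.of σ)
    rw [jacobian, ← Matrix.det_transpose, AlgEquiv.map_det] at hJ
    convert! hJ using 2
    ext i j : 2
    change aeval (fun i => Target.of σ (X i)) (Target.presentation.jacobiMatrix i j) = _
    rw [Algebra.PreSubmersivePresentation.jacobiMatrix_apply]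
    change aeval (fun i => Target.of σ (X i)) (pderiv i (MvPolynomial.map C (σ (X j)) - C (X j))) =
      Target.of σ (pderiv i (σ (X j)))
    rw [map_sub, pderiv_C, sub_zero, pderiv_map, Target.aeval_map_C]
  have : Algebra.IsStandardSmooth (MvPolynomial (Fin n) K) (Target σ) :=
    (Algebra.SubmersivePresentation.mk _ hu).isStandardSmooth
  infer_instance

end Etale

/-! ### Quadratic Jacobian maps are surjective -/

theorem exponent_eq_of_degree_le_two {τ : Type*} (a : τ →₀ ℕ) (h : a.degree ≤ 2) :
    a = 0 ∨ (∃ i, a = Finsupp.single i 1) ∨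
      ∃ i j, a = Finsupp.single i 1 + Finsupp.single j 1 := by
  have step (b : τ →₀ ℕ) (hb : b ≠ 0) : ∃ i c, b = c + Finsupp.single i 1 := by
    obtain ⟨i, hi⟩ := DFunLike.ne_iff.1 hb
    exact ⟨i, b - Finsupp.single i 1,
      (tsub_add_cancel_of_le (Finsupp.single_le_iff.2 (Nat.one_le_iff_ne_zero.2 hi))).symm⟩
  by_cases h0 : a = 0
  · exact Or.inl h0
  obtain ⟨i, b, rfl⟩ := step a h0
  right
  by_cases h1 : b = 0
  · exact Or.inl ⟨i, by rw [h1, zero_add]⟩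
  obtain ⟨j, c, rfl⟩ := step b h1
  right
  have hc : c = 0 := by
    rw [← Finsupp.degree_eq_zero_iff]
    simp only [map_add, Finsupp.degree_single] at h
    omega
  exact ⟨j, i, by rw [hc, zero_add]⟩

/-- The midpoint rule, exact for polynomials of degree at most two. -/
theorem aeval_sub_aeval_eq_sum [CharZero K] {T : Type*} [CommRing T] [Algebra K T]
    (f g : Fin n → T) (p : MvPolynomial (Fin n) K) (hp : p.totalDegree ≤ 2) :
    aeval f p - aeval g p =
      ∑ k, aeval (fun i => algebraMap K T 2⁻¹ * (f i + g i)) (pderiv k p) * (f k - g k) := by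
  have he : algebraMap K T 2⁻¹ * 2 = 1 := by
    rw [← map_ofNat (algebraMap K T) 2, ← map_mul, inv_mul_cancel₀ two_ne_zero, map_one]
  set e := algebraMap K T 2⁻¹
  set h := fun i => e * (f i + g i) with hh
  rw [p.as_sum]
  simp only [map_sum, Finset.sum_mul, ← Finset.sum_sub_distrib]
  rw [Finset.sum_comm]
  refine Finset.sum_congr rfl fun a ha => ?_
  have hX (i k : Fin n) : pderiv k (X i : MvPolynomial (Fin n) K) = if k = i then 1 else 0 := by
    rw [pderiv_X, Pi.single_apply]
    simp only [eq_comm]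
  rcases exponent_eq_of_degree_le_two a ((le_totalDegree ha).trans hp) with
    h0 | ⟨i, h0⟩ | ⟨i, j, h0⟩
  · have hm : monomial a (coeff a p) = C (coeff a p) := by rw [h0]; rfl
    rw [hm]
    simp
  · have hm : monomial a (coeff a p) = C (coeff a p) * X i := by
      rw [h0, C_mul_X_eq_monomial]
    rw [hm]
    have h1 (k : Fin n) : aeval h (pderiv k (C (coeff a p) * X i)) * (f k - g k)
        = if k = i then algebraMap K T (coeff a p) * (f k - g k) else 0 := by
      rw [pderiv_C_mul, hX]
      split_ifs <;> simp
    rw [Finset.sum_congr rfl fun k _ => h1 k, Finset.sum_ite_eq', if_pos (Finset.mem_univ i)]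
    simp only [map_mul, aeval_C, aeval_X]
    ring
  · have hm : monomial a (coeff a p) = C (coeff a p) * (X i * X j) := by
      rw [h0, X, X, monomial_mul, C_mul_monomial, one_mul, mul_one]
    rw [hm]
    have h1 (k : Fin n) : aeval h (pderiv k (C (coeff a p) * (X i * X j))) * (f k - g k)
        = algebraMap K T (coeff a p) *
          ((if k = j then h i * (f k - g k) else 0) + (if k = i then h j * (f k - g k) else 0)) := by
      rw [pderiv_C_mul, Derivation.leibniz, hX, hX]
      split_ifs <;> simp <;> ring
    rw [Finset.sum_congr rfl fun k _ => h1 k, ← Finset.mul_sum, Finset.sum_add_distrib,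
      Finset.sum_ite_eq', Finset.sum_ite_eq', if_pos (Finset.mem_univ i),
      if_pos (Finset.mem_univ j)]
    simp only [map_mul, aeval_C, aeval_X, hh]
    linear_combination (-(algebraMap K T (coeff a p)) * (f i * f j - g i * g j)) * he

theorem mem_range_algebraMap_of_tmul_eq {E L : Type*} [Field E] [Field L] [Algebra E L] (v : L)
    (h : v ⊗ₜ[E] (1 : L) = (1 : L) ⊗ₜ[E] v) : v ∈ Set.range (algebraMap E L) := by
  by_contra hv
  have hv' : v ∉ Submodule.span E {(1 : L)} := by
    rw [Submodule.mem_span_singleton]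
    rintro ⟨c, hc⟩
    exact hv ⟨c, by rw [Algebra.algebraMap_eq_smul_one, hc]⟩
  obtain ⟨φ, hφ, hle⟩ := Submodule.exists_le_ker_of_notMem hv'
  have h1 : φ 1 = 0 := hle (Submodule.mem_span_singleton_self _)
  have h2 := congrArg ((TensorProduct.lid E L).toLinearMap ∘ₗ φ.rTensor L) h
  simp [h1] at h2
  exact hφ h2

/-- By the midpoint rule the two copies of the `x_i` in the tensor square of the extension differ by
a vector killed by an invertible matrix. -/
theorem mem_range_algebraMap_of_quadratic [CharZero K] {E L : Type*} [Field E] [Field L]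
    [Algebra E L] [Algebra K E] [Algebra K L] [IsScalarTower K E L]
    (F : Fin n → MvPolynomial (Fin n) K) (hF : ∀ j, (F j).totalDegree ≤ 2)
    (hJ : IsUnit (jacobianMatrix F).det) (v : Fin n → L)
    (hv : ∀ j, aeval v (F j) ∈ Set.range (algebraMap E L)) (i : Fin n) :
    v i ∈ Set.range (algebraMap E L) := by
  refine mem_range_algebraMap_of_tmul_eq _ ?_
  let f : Fin n → L ⊗[E] L := fun k => v k ⊗ₜ 1
  let g : Fin n → L ⊗[E] L := fun k => 1 ⊗ₜ v k
  have hfg (j : Fin n) : aeval f (F j) = aeval g (F j) := by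
    have h1 : aeval f (F j) = (Algebra.TensorProduct.includeLeft : L →ₐ[K] L ⊗[E] L)
        (aeval v (F j)) := by
      rw [MvPolynomial.comp_aeval_apply]; rfl
    have h2 : aeval g (F j) = ((Algebra.TensorProduct.includeRight :
        L →ₐ[E] L ⊗[E] L).restrictScalars K) (aeval v (F j)) := by
      rw [MvPolynomial.comp_aeval_apply]; rfl
    obtain ⟨e, he⟩ := hv j
    rw [h1, h2, ← he]
    simp
  let A : Matrix (Fin n) (Fin n) (L ⊗[E] L) :=
    (jacobianMatrix F).map (aeval fun i => algebraMap K (L ⊗[E] L) 2⁻¹ * (f i + g i))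
  have hA : IsUnit A := by
    rw [Matrix.isUnit_iff_isUnit_det]
    have := hJ.map (aeval (R := K) fun i => algebraMap K (L ⊗[E] L) 2⁻¹ * (f i + g i))
    rwa [AlgHom.map_det] at this
  have h0 : A.mulVec (fun k => f k - g k) = 0 := by
    ext1 j
    have := aeval_sub_aeval_eq_sum f g (F j) (hF j)
    rw [hfg, sub_self] at this
    exact this.symm
  have h1 := Matrix.mulVec_injective_of_isUnit hA (h0.trans (Matrix.mulVec_zero _).symm)
  exact sub_eq_zero.1 (congrFun h1 i)

variable {σ : MvPolynomial (Fin n) K →ₐ[K] MvPolynomial (Fin n) K}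

/-- Flatness lets an equation between coprime elements of the base be solved only trivially: the
denominator is invertible. -/
theorem isUnit_algebraMap_of_isRelPrime {R S : Type*} [CommRing R] [IsDomain R]
    [UniqueFactorizationMonoid R] [CommRing S] [Algebra R S] [Module.Flat R S] {a b : R}
    (hab : IsRelPrime a b) {v : S} (h : algebraMap R S b * v = algebraMap R S a) :
    IsUnit (algebraMap R S b) := by
  obtain ⟨k, r, y, hy, hr⟩ := Module.Flat.isTrivialRelation_of_sum_smul_eq_zero
    (R := R) (M := S) (f := ![a, b]) (x := ![1, -v]) (by
      simp [Algebra.smul_def, h])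
  have hdvd (j : Fin k) : b ∣ r 0 j := by
    have h1 := hr j
    simp only [Fin.sum_univ_two, Matrix.cons_val_zero, Matrix.cons_val_one] at h1
    refine hab.symm.dvd_of_dvd_mul_left ⟨-r 1 j, ?_⟩
    linear_combination h1
  choose q hq using hdvd
  have h1 := hy 0
  refine IsUnit.of_mul_eq_one (∑ j, q j • y j) ?_
  rw [Matrix.cons_val_zero] at h1
  rw [Finset.mul_sum]
  refine Eq.trans ?_ h1.symm
  refine Finset.sum_congr rfl fun j _ => ?_
  rw [hq j, mul_smul, Algebra.smul_def b]

/-- **Wang's theorem**: a Jacobian map of degree at most two is surjective. Writing `x_i` as a reduced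
fraction over the image of `σ`, the denominator is a unit of `P_n` by flatness, hence a constant. -/
theorem IsJacobianMap.surjective_of_endDegree_le_two [CharZero K] (hσ : IsJacobianMap σ)
    (hd : endDegree σ ≤ 2) : Function.Surjective σ := by
  suffices h : ∀ i, X i ∈ σ.range by
    have h2 : σ.range = ⊤ := by
      rw [eq_top_iff, ← MvPolynomial.adjoin_range_X, Algebra.adjoin_le_iff]
      rintro _ ⟨i, rfl⟩
      exact h i
    exact AlgHom.range_eq_top _ |>.1 h2
  intro i
  have := hσ.flat_target
  have : FaithfulSMul (MvPolynomial (Fin n) K) (FractionRing (Target σ)) := by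
    rw [faithfulSMul_iff_algebraMap_injective, IsScalarTower.algebraMap_eq _ (Target σ)]
    exact (IsFractionRing.injective (Target σ) _).comp hσ.injective
  let : Algebra (FractionRing (MvPolynomial (Fin n) K)) (FractionRing (Target σ)) :=
    FractionRing.liftAlgebra _ _
  have : IsScalarTower (MvPolynomial (Fin n) K) (FractionRing (MvPolynomial (Fin n) K))
    (FractionRing (Target σ)) := FractionRing.isScalarTower_liftAlgebra _ _
  have : IsScalarTower K (FractionRing (MvPolynomial (Fin n) K)) (FractionRing (Target σ)) := by
    refine IsScalarTower.of_algebraMap_eq fun c => ?_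
    rw [IsScalarTower.algebraMap_apply K (MvPolynomial (Fin n) K)
      (FractionRing (MvPolynomial (Fin n) K)), ← IsScalarTower.algebraMap_apply
      (MvPolynomial (Fin n) K) (FractionRing (MvPolynomial (Fin n) K)),
      IsScalarTower.algebraMap_apply (MvPolynomial (Fin n) K) (Target σ),
      ← IsScalarTower.algebraMap_apply K (MvPolynomial (Fin n) K) (Target σ),
      ← IsScalarTower.algebraMap_apply K (Target σ)]
  obtain ⟨z, hz⟩ := mem_range_algebraMap_of_quadratic
    (E := FractionRing (MvPolynomial (Fin n) K)) (L := FractionRing (Target σ))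
    (fun j => σ (X j)) (fun j => (totalDegree_apply_X_le j).trans hd) hσ.isUnit
    (fun i => algebraMap (Target σ) _ (Target.of σ (X i))) (fun j => by
      refine ⟨algebraMap _ _ (X j : MvPolynomial (Fin n) K), ?_⟩
      rw [← IsScalarTower.algebraMap_apply,
        IsScalarTower.algebraMap_apply (MvPolynomial (Fin n) K) (Target σ), Target.algebraMap_apply]
      have h := comp_aeval_apply (R := K) (σ := Fin n) (φ := (IsScalarTower.toAlgHom K (Target σ)
        (FractionRing (Target σ))).comp (Target.of σ).toAlgHom) X (σ (X j))
      rw [aeval_X_left_apply] at h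
      exact h) i
  obtain ⟨a, b, hab, rfl⟩ := IsFractionRing.exists_reduced_fraction (MvPolynomial (Fin n) K) z
  have h1 : algebraMap _ (Target σ) (b : MvPolynomial (Fin n) K) * Target.of σ (X i) =
      algebraMap _ (Target σ) a := by
    apply IsFractionRing.injective (Target σ) (FractionRing (Target σ))
    rw [map_mul, ← hz, ← IsScalarTower.algebraMap_apply, ← IsScalarTower.algebraMap_apply,
      IsScalarTower.algebraMap_apply (MvPolynomial (Fin n) K)
        (FractionRing (MvPolynomial (Fin n) K)) (FractionRing (Target σ)) a,
      IsScalarTower.algebraMap_apply (MvPolynomial (Fin n) K)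
        (FractionRing (MvPolynomial (Fin n) K)) (FractionRing (Target σ)) (b : _), ← map_mul,
      IsLocalization.mk'_spec']
  have hu : IsUnit (σ b) := isUnit_algebraMap_of_isRelPrime (S := Target σ) hab h1
  obtain ⟨c, hc, hcb⟩ := MvPolynomial.isUnit_iff_eq_C_of_isReduced.1 hu
  have hbc : (b : MvPolynomial (Fin n) K) = C c := by
    refine hσ.injective ?_
    rw [hcb, ← algebraMap_eq, AlgHom.commutes]
  have h2 : C c * X i = σ a := by
    rw [← hcb]
    exact h1
  refine ⟨a * C c⁻¹, ?_⟩
  have h3 : σ (C c⁻¹) = C c⁻¹ := by rw [← algebraMap_eq, AlgHom.commutes]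
  change σ _ = _
  rw [map_mul, h3, ← h2, mul_right_comm, ← C_mul,
    mul_inv_cancel₀ hc.ne_zero, C_1, one_mul]

end JacWeyl

end

/-! ### The length bound -/

namespace JacWeyl

theorem mul_le_pow_of_two_le {a : ℕ} (ha : 2 ≤ a) (k : ℕ) : k * a ≤ a ^ k := by
  rcases k with _ | k
  · simp
  · rw [pow_succ]
    exact Nat.mul_le_mul_right _ (Nat.lt_pow_self (by omega))

/-- For a degree other than two, the increment by which the generators raise degrees is at most the
increment in the statement. -/
theorem natCast_max_le {d : ℕ} (hd : d ≠ 2) (n : ℕ) :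
    ((max d ((n - 1) * (d - 1) - 1) : ℕ) : ℤ) ≤ max (d : ℤ) (((d : ℤ) - 1) ^ (n - 1) - 1) := by
  rcases Nat.lt_or_ge d 2 with h | h
  · refine le_trans ?_ (le_max_left _ _)
    rw [Nat.sub_eq_zero_of_le (show d ≤ 1 by omega)]
    simp
  · have h1 := mul_le_pow_of_two_le (a := d - 1) (by omega) (n - 1)
    have h2 : ((d - 1 : ℕ) : ℤ) = (d : ℤ) - 1 := by omega
    have h3 : (((d - 1) ^ (n - 1) : ℕ) : ℤ) = ((d : ℤ) - 1) ^ (n - 1) := by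
      rw [← h2]; push_cast; rfl
    have h4 : 0 < (d - 1) ^ (n - 1) := Nat.pow_pos (by omega)
    rw [← h3]
    omega

end JacWeyl

theorem mainTheorem1 {K : Type*} [Field K] [CharZero K] {n : ℕ} (hn : 1 ≤ n)
    (σ : MvPolynomial (Fin n) K →ₐ[K] MvPolynomial (Fin n) K)
    (hσ : JacWeyl.IsJacobianMap σ) (d : ℕ) (hd : d = JacWeyl.endDegree σ) :
    JacWeyl.IsHolonomic K n (JacWeyl.Twisted hσ.extend (MvPolynomial (Fin n) K)) ∧
    IsFiniteLength (JacWeyl.Weyl K n)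
      (JacWeyl.Twisted hσ.extend (MvPolynomial (Fin n) K)) ∧
    (∃ v : JacWeyl.Twisted hσ.extend (MvPolynomial (Fin n) K),
      Submodule.span (JacWeyl.Weyl K n) {v} = ⊤) ∧
    ∃ l : ℕ,
      Module.length (JacWeyl.Weyl K n)
        (JacWeyl.Twisted hσ.extend (MvPolynomial (Fin n) K)) = (l : ℕ∞) ∧
      (l : ℤ) ≤ (max (d : ℤ) (((d : ℤ) - 1) ^ (n - 1) - 1)) ^ n := by
  subst hd
  have hF := JacWeyl.isDegreeFiltration_twistedFiltration hσ
  have hlen := hF.length_le hn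
  have hfin : IsFiniteLength (JacWeyl.Weyl K n)
      (JacWeyl.Twisted hσ.extend (MvPolynomial (Fin n) K)) :=
    Module.length_ne_top_iff.1 (ne_top_of_le_ne_top (ENat.natCast_ne_top _) hlen)
  have hNA := isFiniteLength_iff_isNoetherian_isArtinian.1 hfin
  have := hNA.1
  have := hNA.2
  refine ⟨⟨inferInstance, hF.gkDim_eq hn⟩, hfin,
    JacWeyl.Weyl.exists_span_singleton_eq_top (hF.exists_quantize_smul_eq_zero hn), ?_⟩
  by_cases h2 : JacWeyl.endDegree σ = 2
  · -- The estimate by degrees is too weak here, but a quadratic Jacobian map is surjective.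
    have := hσ.isSimpleModule_twisted (hσ.surjective_of_endDegree_le_two h2.le)
    refine ⟨1, by simp, ?_⟩
    refine one_le_pow₀ (le_trans ?_ (le_max_left _ _))
    rw [h2]
    norm_num
  · obtain ⟨l, hl⟩ := ENat.ne_top_iff_exists.1 (Module.length_ne_top_iff.2 hfin)
    refine ⟨l, hl.symm, ?_⟩
    rw [← hl] at hlen
    calc (l : ℤ) ≤ (((max (JacWeyl.endDegree σ)
            ((n - 1) * (JacWeyl.endDegree σ - 1) - 1)) ^ n : ℕ) : ℤ) := by
          exact_mod_cast hlen
      _ ≤ _ := by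
          rw [Nat.cast_pow]
          exact pow_le_pow_left₀ (Int.natCast_nonneg _) (JacWeyl.natCast_max_le h2 n) n
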